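/- Let $\ell>0$ and $\mathcal H=L^2([0,\ell])$ (inner products are conjugate-linear in the first variable; units with $\hbar=1$). Let $U:L^2([0,\ell])\to L^2(\mathbb R)$ be extension by zero, let $\mathcal F$ be the Fourier-Plancherel operator on $L^2(\mathbb R)$, $(\mathcal F\psi)(x)=(2\pi)^{-1/2}\int e^{-ixt}\psi(t)\,dt$, and let $\mathsf Q(Y)$ be multiplication by the indicator function $\chi_Y$ on $L^2(\mathbb R)$. The truncated momentum observable is the positive operator valued measure $\mathsf P(Y)=U^*\mathcal F^*\mathsf Q(Y)\mathcal F U$ (for Borel sets $Y\subseteq\mathbb R$) on $\mathcal H$. Write $\mathsf P_{\psi,\varphi}(Y)=\langle\psi|\mathsf P(Y)\varphi\rangle$. For $k\in\mathbb N=\{0,1,2,\dots\}$ let $D_k=\{\varphi\in\mathcal H:\int|x|^k\,d\mathsf P_{\varphi,\varphi}(x)<\infty\}$. The largest symmetric weak $k$-th moment $\mathsf P'[k]$ is the operator with domain $$\Big\{\varphi\in D_k:\ D_k\ni\psi\mapsto\int x^k\,d\mathsf P_{\psi,\varphi}(x)\ \text{is continuous for the norm of }\mathcal H\Big\}$$ which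 is determined by $\langle\psi|\mathsf P'[k]\varphi\rangle=\int x^k\,d\mathsf P_{\psi,\varphi}(x)$ for all $\psi\in D_k$. The strong $k$-th moment $\mathsf P[k]$ is the operator with domain $\{\varphi\in\mathcal H:\int|x|^k\,d|\mathsf P_{\psi,\varphi}|(x)<\infty\ \text{for all }\psi\in\mathcal H\}$ which is determined by $\langle\psi|\mathsf P[k]\varphi\rangle=\int x^k\,d\mathsf P_{\psi,\varphi}(x)$ for all $\psi\in\mathcal H$. Let $H^0([0,\ell])=\mathcal H$ and, for $n\ge1$, let $H^n([0,\ell])$ be the space of all $(n-1)$-times continuously differentiable $\varphi:[0,\ell]\to\mathbb C$ such that $\varphi^{(n-1)}$ is absolutely continuous and $\varphi^{(n)}\in L^2([0,\ell])$. Let $P_0=-i\,d/dx$ with domain $\{\varphi\in H^1([0,\ell]):\varphi(0)=\varphi(\ell)=0\}$. Products and powers of unbounded operators have their natural domains, and $P_0^0=I$. Proposition. All $D_k$ and all domains $\mathrm{dom}(P_0^n)$ are dense in $\mathcal H$ (so the operators $\mathsf P'[k]$ and $(P_0^n)^*$ are well defined), and the following equalities of operators, including their domains, hold. 1. $\mathsf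 P'[1]=P_0$. 2. $\mathsf P'[2n]=(P_0^n)^*P_0^n$ for all $n\in\mathbb N$. 3. For all $n\in\mathbb N$, both $\mathsf P[2n]=P_0^{2n}$ and $\mathsf P'[2n]$ act as $(-1)^n d^{2n}/dx^{2n}$, and they differ by boundary conditions: $$\mathrm{dom}(\mathsf P[2n])=\{\varphi\in H^{2n}([0,\ell]):\ \varphi^{(k)}(0)=\varphi^{(k)}(\ell)=0,\ k=0,\dots,2n-1\},$$ $$\mathrm{dom}(\mathsf P'[2n])=\{\varphi\in H^{2n}([0,\ell]):\ \varphi^{(k)}(0)=\varphi^{(k)}(\ell)=0,\ k=0,\dots,n-1\}.$$ 4. In particular $\mathsf P'[2]=P_0^*P_0$, and for every $m>0$ one has $\mathsf P'[2]=2m\,H_m$, where $H_m=-\frac1{2m}\frac{d^2}{dx^2}$ with domain $\{\varphi\in H^2([0,\ell]):\varphi(0)=\varphi(\ell)=0\}$ is the Dirichlet Hamiltonian of a particle of mass $m$ in the box $[0,\ell]$. -/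

import Mathlib

open MeasureTheory Set
open scoped InnerProductSpace ENNReal NNReal

noncomputable section

/-- Positive operator valued measure: a strongly σ-additive map from the measurable sets to the
positive bounded operators (its values on non-measurable sets are irrelevant). -/
structure POVM (Ω : Type*) [MeasurableSpace Ω] (H : Type*) [NormedAddCommGroup H]
    [InnerProductSpace ℂ H] where
  op : Set Ω → H →L[ℂ] H
  isPositive : ∀ X, MeasurableSet X → (op X).IsPositive
  hasSum : ∀ X : ℕ → Set Ω, (∀ i, MeasurableSet (X i)) →
    Pairwise (fun i j => Disjoint (X i) (X j)) →
    ∀ φ : H, HasSum (fun i => op (X i) φ) (op (⋃ i, X i) φ)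

namespace POVM

variable {Ω : Type*} [MeasurableSpace Ω] {H : Type*} [NormedAddCommGroup H]
  [InnerProductSpace ℂ H]

theorem op_empty_apply (E : POVM Ω H) (φ : H) : E.op ∅ φ = 0 := by
  have h := E.hasSum (fun _ => ∅) (fun _ => MeasurableSet.empty) (fun _ _ _ => by simp) φ
  have h2 := h.summable
  rwa [summable_const_iff] at h2

open scoped Classical in
/-- The complex measure `E_{ψ,φ} : X ↦ ⟪ψ, E(X) φ⟫`. -/
def complexMeasure (E : POVM Ω H) (ψ φ : H) : ComplexMeasure Ω where
  measureOf' X := if MeasurableSet X then ⟪ψ, E.op X φ⟫_ℂ else 0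
  empty' := by simp [E.op_empty_apply]
  not_measurable' X hX := by simp [hX]
  m_iUnion' X hX hd := by
    have h := (E.hasSum X hX hd φ).mapL (innerSL ℂ ψ)
    simpa [hX, MeasurableSet.iUnion hX] using h

theorem complexMeasure_apply (E : POVM Ω H) (ψ φ : H) {X : Set Ω} (hX : MeasurableSet X) :
    E.complexMeasure ψ φ X = ⟪ψ, E.op X φ⟫_ℂ := by
  classical
  change (if MeasurableSet X then _ else _) = _
  exact if_pos hX

theorem complexMeasure_add_right (E : POVM Ω H) (ψ φ φ' : H) :
    E.complexMeasure ψ (φ + φ') = E.complexMeasure ψ φ + E.complexMeasure ψ φ' := by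
  ext X hX
  simp [complexMeasure_apply, hX]

theorem complexMeasure_add_left (E : POVM Ω H) (ψ ψ' φ : H) :
    E.complexMeasure (ψ + ψ') φ = E.complexMeasure ψ φ + E.complexMeasure ψ' φ := by
  ext X hX
  simp [complexMeasure_apply, hX]

theorem complexMeasure_smul_right (E : POVM Ω H) (ψ φ : H) (c : ℂ) :
    E.complexMeasure ψ (c • φ) = c • E.complexMeasure ψ φ := by
  ext X hX
  simp [complexMeasure_apply, hX]

theorem complexMeasure_smul_left (E : POVM Ω H) (ψ φ : H) (c : ℂ) :
    E.complexMeasure (c • ψ) φ = (starRingEnd ℂ c) • E.complexMeasure ψ φ := by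
  ext X hX
  simp [complexMeasure_apply, hX, mul_comm]

theorem enorm_complexMeasure_le (E : POVM Ω H) (ψ φ : H) {X : Set Ω} (hX : MeasurableSet X) :
    ‖E.complexMeasure ψ φ X‖ₑ ≤ ‖E.complexMeasure ψ ψ X‖ₑ + ‖E.complexMeasure φ φ X‖ₑ := by
  rw [complexMeasure_apply _ _ _ hX, complexMeasure_apply _ _ _ hX, complexMeasure_apply _ _ _ hX]
  have hp := E.isPositive X hX
  set A := E.op X
  have h0 : ∀ χ : H, ‖⟪χ, A χ⟫_ℂ‖ = RCLike.re ⟪χ, A χ⟫_ℂ := fun χ =>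
    (congrArg Complex.re (Complex.norm_of_nonneg' (hp.inner_nonneg_right χ)) :)
  have hs : ⟪φ, A ψ⟫_ℂ = starRingEnd ℂ ⟪ψ, A φ⟫_ℂ := by
    rw [inner_conj_symm, hp.inner_left_eq_inner_right]
  have key : ‖⟪ψ, A φ⟫_ℂ‖ ≤ ‖⟪ψ, A ψ⟫_ℂ‖ + ‖⟪φ, A φ⟫_ℂ‖ := by
    set z := ⟪ψ, A φ⟫_ℂ
    obtain ⟨u, hu, huz⟩ : ∃ u : ℂ, ‖u‖ = 1 ∧ (u * z).re = -‖z‖ := by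
      rcases eq_or_ne z 0 with hz | hz
      · exact ⟨1, by simp, by simp [hz]⟩
      · refine ⟨-(starRingEnd ℂ z / ‖z‖), by simp [hz], ?_⟩
        have : -(starRingEnd ℂ z / ‖z‖) * z = -((‖z‖ : ℝ) : ℂ) := by
          have hz' : ((‖z‖ : ℝ) : ℂ) ≠ 0 := by simpa using hz
          field_simp
          rw [mul_comm, Complex.mul_conj, Complex.normSq_eq_norm_sq]
          push_cast; ring
        rw [this]; simp
    have h1 := hp.re_inner_nonneg_right (ψ + u • φ)
    have hsq : (starRingEnd ℂ u) * u = 1 := by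
      rw [mul_comm, Complex.mul_conj, Complex.normSq_eq_norm_sq, hu]; simp
    simp only [map_add, map_smul, inner_add_left, inner_add_right, inner_smul_left,
      inner_smul_right, hs, mul_add] at h1
    have e1 : u * ((starRingEnd ℂ u) * ⟪φ, A φ⟫_ℂ) = ⟪φ, A φ⟫_ℂ := by
      rw [← mul_assoc, mul_comm u, hsq, one_mul]
    have e2 : (starRingEnd ℂ u) * (starRingEnd ℂ z) = starRingEnd ℂ (u * z) := by simp
    simp only [e1, e2] at h1
    rw [h0, h0]
    simp only [RCLike.re_to_complex] at *
    simp only [Complex.conj_re, huz] at h1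
    have : 0 ≤ ‖z‖ := norm_nonneg _
    nlinarith [this, h1]
  rw [← ofReal_norm, ← ofReal_norm, ← ofReal_norm, ← ENNReal.ofReal_add (by positivity) (by positivity)]
  exact ENNReal.ofReal_le_ofReal key

theorem variation_complexMeasure_le (E : POVM Ω H) (ψ φ : H) :
    (E.complexMeasure ψ φ).variation ≤
      (E.complexMeasure ψ ψ).variation + (E.complexMeasure φ φ).variation := by
  refine VectorMeasure.variation_le_of_forall_enorm_le fun X hX => ?_
  refine (E.enorm_complexMeasure_le ψ φ hX).trans ?_
  rw [Measure.add_apply]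
  exact add_le_add (VectorMeasure.enorm_measure_le_variation _ _)
    (VectorMeasure.enorm_measure_le_variation _ _)

end POVM

theorem setToFun_I_mul {Ω : Type*} [MeasurableSpace Ω] {m m' : Measure Ω}
    (hm : m' = m) {T T' : Set Ω → ℂ →L[ℝ] ℂ} {C C' : ℝ} (hT : DominatedFinMeasAdditive m T C) (hT' : DominatedFinMeasAdditive m' T' C')
    (h : ∀ s, MeasurableSet s → ∀ x, T' s x = Complex.I * T s x) (f : Ω → ℂ) :
    setToFun m' T' hT' f = Complex.I * setToFun m T hT f := by
  subst hm
  by_cases hf : Integrable f m'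
  swap
  · simp [setToFun_undef _ hf]
  refine Integrable.induction
    (fun f => setToFun m' T' hT' f = Complex.I * setToFun m' T hT f) ?_ ?_ ?_ ?_ hf
  · intro c s hs hfin
    rw [setToFun_indicator_const hT' hs hfin.ne, setToFun_indicator_const hT hs hfin.ne, h s hs]
  · intro f g _ hf hg h1 h2
    rw [setToFun_add hT' hf hg, setToFun_add hT hf hg, h1, h2, mul_add]
  · exact isClosed_eq (continuous_setToFun hT') (continuous_const.mul (continuous_setToFun hT))
  · intro f g hfg _ h1
    rw [← setToFun_congr_ae hT' hfg, ← setToFun_congr_ae hT hfg, h1]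

theorem integral_I_smul_complexMeasure {Ω : Type*} [MeasurableSpace Ω] (μ : ComplexMeasure Ω)
    (f : Ω → ℂ) :
    ∫ᵛ x, f x ∂[ContinuousLinearMap.mul ℝ ℂ; Complex.I • μ] =
      Complex.I * ∫ᵛ x, f x ∂[ContinuousLinearMap.mul ℝ ℂ; μ] := by
  have hv : (Complex.I • μ).variation = μ.variation := by
    rw [VectorMeasure.variation_smul]; simp
  refine setToFun_I_mul hv _ _ (fun s _ x => ?_) f
  simp only [transpose_eq_cbmApplyMeasure, cbmApplyMeasure_apply, VectorMeasure.smul_apply,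
    ContinuousLinearMap.mul_apply', smul_eq_mul]
  ring

theorem integral_smul_complexMeasure {Ω : Type*} [MeasurableSpace Ω] (μ : ComplexMeasure Ω)
    (f : Ω → ℂ) (c : ℂ) (hf : μ.Integrable f) :
    ∫ᵛ x, f x ∂[ContinuousLinearMap.mul ℝ ℂ; c • μ] =
      c * ∫ᵛ x, f x ∂[ContinuousLinearMap.mul ℝ ℂ; μ] := by
  have hc : c • μ = c.re • μ + c.im • (Complex.I • μ) := by
    ext X hX
    simp only [VectorMeasure.smul_apply, VectorMeasure.add_apply, smul_eq_mul, Complex.real_smul]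
    conv_lhs => rw [← Complex.re_add_im c]
    ring
  have hI : (Complex.I • μ).Integrable f := by
    rw [VectorMeasure.Integrable, VectorMeasure.variation_smul]; simpa using hf
  rw [hc, VectorMeasure.integral_add_vectorMeasure (hf.smul_vectorMeasure _)
    (hI.smul_vectorMeasure _), VectorMeasure.integral_smul_vectorMeasure,
    VectorMeasure.integral_smul_vectorMeasure, integral_I_smul_complexMeasure]
  conv_rhs => rw [← Complex.re_add_im c]
  simp only [Complex.real_smul]
  ring

namespace POVM

variable {Ω : Type*} [MeasurableSpace Ω] {H : Type*} [NormedAddCommGroup H]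
  [InnerProductSpace ℂ H]

/-- The integral `∫ f dE_{ψ,φ}` with respect to the complex measure `E_{ψ,φ}`. -/
def formIntegral (E : POVM Ω H) (f : Ω → ℂ) (ψ φ : H) : ℂ :=
  ∫ᵛ x, f x ∂[ContinuousLinearMap.mul ℝ ℂ; E.complexMeasure ψ φ]

theorem integrable_smul {μ : ComplexMeasure Ω} {f : Ω → ℂ} (hf : μ.Integrable f) (c : ℂ) :
    (c • μ).Integrable f := by
  rw [VectorMeasure.Integrable, VectorMeasure.variation_smul]
  exact hf.smul_measure_nnreal

theorem integrable_of_diag (E : POVM Ω H) {f : Ω → ℂ} {ψ φ : H}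
    (hψ : (E.complexMeasure ψ ψ).Integrable f) (hφ : (E.complexMeasure φ φ).Integrable f) :
    (E.complexMeasure ψ φ).Integrable f :=
  (integrable_add_measure.2 ⟨hψ, hφ⟩).mono_measure (E.variation_complexMeasure_le ψ φ)

theorem complexMeasure_zero_right (E : POVM Ω H) (ψ : H) : E.complexMeasure ψ 0 = 0 := by
  ext X hX
  simp [complexMeasure_apply, hX]

/-- The form domain `{φ | ∫ |f| dE_{φ,φ} < ∞}`. -/
def formDomain (E : POVM Ω H) (f : Ω → ℂ) : Submodule ℂ H where
  carrier := {φ | (E.complexMeasure φ φ).Integrable f}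
  zero_mem' := by
    change (E.complexMeasure 0 0).Integrable f
    rw [complexMeasure_zero_right]
    exact VectorMeasure.Integrable.zero_vectorMeasure
  add_mem' := by
    intro φ ψ hφ hψ
    change (E.complexMeasure (φ + ψ) (φ + ψ)).Integrable f
    rw [complexMeasure_add_left, complexMeasure_add_right, complexMeasure_add_right]
    exact VectorMeasure.Integrable.add_vectorMeasure
      (VectorMeasure.Integrable.add_vectorMeasure hφ (E.integrable_of_diag hφ hψ))
      (VectorMeasure.Integrable.add_vectorMeasure (E.integrable_of_diag hψ hφ) hψ)
  smul_mem' := by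
    intro c φ hφ
    change (E.complexMeasure (c • φ) (c • φ)).Integrable f
    rw [complexMeasure_smul_left, complexMeasure_smul_right]
    exact integrable_smul (integrable_smul hφ _) _

theorem integrable_of_mem (E : POVM Ω H) {f : Ω → ℂ} {ψ φ : H} (hψ : ψ ∈ E.formDomain f)
    (hφ : φ ∈ E.formDomain f) : (E.complexMeasure ψ φ).Integrable f :=
  E.integrable_of_diag hψ hφ

theorem formIntegral_add_right (E : POVM Ω H) {f : Ω → ℂ} {ψ φ φ' : H}
    (h : (E.complexMeasure ψ φ).Integrable f) (h' : (E.complexMeasure ψ φ').Integrable f) :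
    E.formIntegral f ψ (φ + φ') = E.formIntegral f ψ φ + E.formIntegral f ψ φ' := by
  rw [formIntegral, complexMeasure_add_right, VectorMeasure.integral_add_vectorMeasure h h']
  rfl

theorem formIntegral_add_left (E : POVM Ω H) {f : Ω → ℂ} {ψ ψ' φ : H}
    (h : (E.complexMeasure ψ φ).Integrable f) (h' : (E.complexMeasure ψ' φ).Integrable f) :
    E.formIntegral f (ψ + ψ') φ = E.formIntegral f ψ φ + E.formIntegral f ψ' φ := by
  rw [formIntegral, complexMeasure_add_left, VectorMeasure.integral_add_vectorMeasure h h']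
  rfl

theorem formIntegral_smul_right (E : POVM Ω H) {f : Ω → ℂ} {ψ φ : H} (c : ℂ)
    (h : (E.complexMeasure ψ φ).Integrable f) :
    E.formIntegral f ψ (c • φ) = c * E.formIntegral f ψ φ := by
  rw [formIntegral, complexMeasure_smul_right, integral_smul_complexMeasure _ _ _ h]
  rfl

theorem formIntegral_smul_left (E : POVM Ω H) {f : Ω → ℂ} {ψ φ : H} (c : ℂ)
    (h : (E.complexMeasure ψ φ).Integrable f) :
    E.formIntegral f (c • ψ) φ = starRingEnd ℂ c * E.formIntegral f ψ φ := by
  rw [formIntegral, complexMeasure_smul_left, integral_smul_complexMeasure _ _ _ h]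
  rfl

/-- The domain of the largest symmetric weak operator integral: those `φ` in the form domain `D`
for which `D ∋ ψ ↦ ∫ f dE_{ψ,φ}` is continuous (in the norm of the Hilbert space). -/
def weakDomain (E : POVM Ω H) (f : Ω → ℂ) : Submodule ℂ H where
  carrier := {φ | φ ∈ E.formDomain f ∧
    Continuous fun ψ : E.formDomain f => E.formIntegral f (ψ : H) φ}
  zero_mem' := by
    refine ⟨zero_mem _, ?_⟩
    have h : ∀ ψ : E.formDomain f, E.formIntegral f (ψ : H) 0 = 0 := fun ψ => by
      have := E.formIntegral_smul_right 0 (E.integrable_of_mem ψ.2 (zero_mem _))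
      simpa using this
    simp only [h]
    exact continuous_const
  add_mem' := by
    rintro φ φ' ⟨hφ, hc⟩ ⟨hφ', hc'⟩
    refine ⟨add_mem hφ hφ', ?_⟩
    refine (hc.add hc').congr fun ψ => ?_
    exact (E.formIntegral_add_right (E.integrable_of_mem ψ.2 hφ)
      (E.integrable_of_mem ψ.2 hφ')).symm
  smul_mem' := by
    rintro c φ ⟨hφ, hc⟩
    refine ⟨Submodule.smul_mem _ c hφ, ?_⟩
    refine (hc.const_mul c).congr fun ψ => ?_
    exact (E.formIntegral_smul_right c (E.integrable_of_mem ψ.2 hφ)).symm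

theorem exists_weak [CompleteSpace H] (E : POVM Ω H) (f : Ω → ℂ)
    (hD : Dense (E.formDomain f : Set H)) {φ : H} (hφ : φ ∈ E.weakDomain f) :
    ∃ η : H, ∀ ψ ∈ E.formDomain f, ⟪ψ, η⟫_ℂ = E.formIntegral f ψ φ := by
  let g : StrongDual ℂ (E.formDomain f) :=
    { toFun := fun ψ => starRingEnd ℂ (E.formIntegral f (ψ : H) φ)
      map_add' := fun ψ ψ' => by
        rw [Submodule.coe_add, E.formIntegral_add_left (E.integrable_of_mem ψ.2 hφ.1)
          (E.integrable_of_mem ψ'.2 hφ.1), map_add]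
      map_smul' := fun c ψ => by
        rw [Submodule.coe_smul, E.formIntegral_smul_left c (E.integrable_of_mem ψ.2 hφ.1),
          map_mul, Complex.conj_conj]
        rfl
      cont := Complex.continuous_conj.comp hφ.2 }
  let G : StrongDual ℂ H := g.extend (Submodule.subtypeL (E.formDomain f))
  have hG : ∀ ψ : E.formDomain f, G (ψ : H) = g ψ := fun ψ =>
    ContinuousLinearMap.extend_eq _ hD.denseRange_val
      isUniformEmbedding_subtype_val.isUniformInducing _
  refine ⟨(InnerProductSpace.toDual ℂ H).symm G, fun ψ hψ => ?_⟩
  rw [← inner_conj_symm, InnerProductSpace.toDual_symm_apply, hG ⟨ψ, hψ⟩]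
  exact Complex.conj_conj _

theorem weak_unique (E : POVM Ω H) (f : Ω → ℂ)
    (hD : Dense (E.formDomain f : Set H)) {η η' : H}
    (h : ∀ ψ ∈ E.formDomain f, ⟪ψ, η⟫_ℂ = ⟪ψ, η'⟫_ℂ) : η = η' :=
  hD.eq_of_inner_right ℂ h

/-- The largest symmetric weak operator integral as a linear map on its domain. -/
def weakAux [CompleteSpace H] (E : POVM Ω H) (f : Ω → ℂ)
    (hD : Dense (E.formDomain f : Set H)) : E.weakDomain f →ₗ[ℂ] H where
  toFun φ := (E.exists_weak f hD φ.2).choose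
  map_add' φ φ' := E.weak_unique f hD fun ψ hψ => by
    rw [inner_add_right, (E.exists_weak f hD (φ + φ').2).choose_spec ψ hψ,
      (E.exists_weak f hD φ.2).choose_spec ψ hψ, (E.exists_weak f hD φ'.2).choose_spec ψ hψ]
    exact E.formIntegral_add_right (E.integrable_of_mem hψ φ.2.1)
      (E.integrable_of_mem hψ φ'.2.1)
  map_smul' c φ := E.weak_unique f hD fun ψ hψ => by
    rw [RingHom.id_apply, inner_smul_right, (E.exists_weak f hD (c • φ).2).choose_spec ψ hψ,
      (E.exists_weak f hD φ.2).choose_spec ψ hψ]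
    exact E.formIntegral_smul_right c (E.integrable_of_mem hψ φ.2.1)

open scoped Classical in
/-- The largest symmetric weak operator integral `L'(f, E)`, i.e. the operator on `weakDomain`
determined by `⟪ψ, L'(f, E) φ⟫ = ∫ f dE_{ψ,φ}` for all `ψ` in the form domain. It is meaningful
only if the form domain is dense (the value is set to zero otherwise). -/
def weakIntegral [CompleteSpace H] (E : POVM Ω H) (f : Ω → ℂ) : H →ₗ.[ℂ] H where
  domain := E.weakDomain f
  toFun := if hD : Dense (E.formDomain f : Set H) then E.weakAux f hD else 0

theorem inner_weakIntegral [CompleteSpace H] (E : POVM Ω H) (f : Ω → ℂ)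
    (hD : Dense (E.formDomain f : Set H)) (φ : (E.weakIntegral f).domain) {ψ : H}
    (hψ : ψ ∈ E.formDomain f) :
    ⟪ψ, E.weakIntegral f φ⟫_ℂ = E.formIntegral f ψ φ := by
  have h : E.weakIntegral f φ = E.weakAux f hD φ := by
    classical
    change (if hD : Dense (E.formDomain f : Set H) then E.weakAux f hD else 0) φ = _
    rw [dif_pos hD]
  rw [h]
  exact (E.exists_weak f hD φ.2).choose_spec ψ hψ

/-- The domain of the maximal strong operator integral:
those `φ` with `∫ |f| d|E_{ψ,φ}| < ∞` for all `ψ`. -/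
def strongDomain (E : POVM Ω H) (f : Ω → ℂ) : Submodule ℂ H where
  carrier := {φ | ∀ ψ : H, (E.complexMeasure ψ φ).Integrable f}
  zero_mem' := by
    intro ψ
    rw [complexMeasure_zero_right]
    exact VectorMeasure.Integrable.zero_vectorMeasure
  add_mem' := by
    intro φ φ' h h' ψ
    rw [complexMeasure_add_right]
    exact (h ψ).add_vectorMeasure (h' ψ)
  smul_mem' := by
    intro c φ h ψ
    rw [complexMeasure_smul_right]
    exact integrable_smul (h ψ) c

theorem formIntegral_simpleFunc (E : POVM Ω H) (f : SimpleFunc Ω ℂ) (ψ φ : H)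
    (hf : (E.complexMeasure ψ φ).Integrable f) :
    E.formIntegral f ψ φ = ⟪ψ, ∑ c ∈ f.range, c • E.op (f ⁻¹' {c}) φ⟫_ℂ := by
  rw [formIntegral, VectorMeasure.integral, setToFun_simpleFunc _ _ hf, inner_sum]
  refine Finset.sum_congr rfl fun c _ => ?_
  rw [transpose_eq_cbmApplyMeasure, cbmApplyMeasure_apply, ContinuousLinearMap.mul_apply',
    E.complexMeasure_apply _ _ (f.measurableSet_fiber c), inner_smul_right]

theorem exists_strong [CompleteSpace H] (E : POVM Ω H) {f : Ω → ℂ} (hf : Measurable f) {φ : H}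
    (hφ : φ ∈ E.strongDomain f) : ∃ η : H, ∀ ψ, ⟪ψ, η⟫_ℂ = E.formIntegral f ψ φ := by
  let F : ℕ → SimpleFunc Ω ℂ := fun n => SimpleFunc.approxOn f hf univ 0 (mem_univ _) n
  have hbound : ∀ n x, ‖F n x‖ ≤ ‖f x‖ + ‖f x‖ := fun n x =>
    SimpleFunc.norm_approxOn_zero_le hf (mem_univ _) x n
  have hint : ∀ n ψ, (E.complexMeasure ψ φ).Integrable (F n) := fun n ψ =>
    ((hφ ψ).norm.add (hφ ψ).norm).mono' (F n).measurable.aestronglyMeasurable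
      (Filter.Eventually.of_forall (hbound n))
  have hlim : ∀ ψ, Filter.Tendsto (fun n => E.formIntegral (F n) ψ φ) Filter.atTop
      (nhds (E.formIntegral f ψ φ)) := fun ψ =>
    VectorMeasure.tendsto_integral_of_dominated_convergence (fun x => ‖f x‖ + ‖f x‖)
      (fun n => (F n).measurable.aestronglyMeasurable) ((hφ ψ).norm.add (hφ ψ).norm)
      (fun n => Filter.Eventually.of_forall (hbound n))
      (Filter.Eventually.of_forall fun x => SimpleFunc.tendsto_approxOn hf (mem_univ _) (by simp))
  let g : ℕ → StrongDual ℂ H := fun n =>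
    innerSL ℂ (∑ c ∈ (F n).range, c • E.op (F n ⁻¹' {c}) φ)
  have hg : Filter.Tendsto (fun n ψ => g n ψ) Filter.atTop
      (nhds fun ψ => starRingEnd ℂ (E.formIntegral f ψ φ)) := by
    rw [tendsto_pi_nhds]
    intro ψ
    refine ((Complex.continuous_conj.tendsto _).comp (hlim ψ)).congr fun n => ?_
    simp only [Function.comp_apply, E.formIntegral_simpleFunc _ _ _ (hint n ψ), inner_conj_symm]
    rfl
  refine ⟨(InnerProductSpace.toDual ℂ H).symm (continuousLinearMapOfTendsto g hg), fun ψ => ?_⟩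
  rw [← inner_conj_symm, InnerProductSpace.toDual_symm_apply]
  exact Complex.conj_conj _

/-- The maximal strong operator integral `L(f, E)`, determined by
`⟪ψ, L(f, E) φ⟫ = ∫ f dE_{ψ,φ}` for all `ψ`. -/
def strongIntegral [CompleteSpace H] (E : POVM Ω H) (f : Ω → ℂ) (hf : Measurable f) :
    H →ₗ.[ℂ] H where
  domain := E.strongDomain f
  toFun :=
    { toFun := fun φ => (E.exists_strong hf φ.2).choose
      map_add' := fun φ φ' => ext_inner_left ℂ fun ψ => by
        rw [inner_add_right, (E.exists_strong hf (φ + φ').2).choose_spec ψ,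
          (E.exists_strong hf φ.2).choose_spec ψ, (E.exists_strong hf φ'.2).choose_spec ψ]
        exact E.formIntegral_add_right (φ.2 ψ) (φ'.2 ψ)
      map_smul' := fun c φ => ext_inner_left ℂ fun ψ => by
        rw [RingHom.id_apply, inner_smul_right, (E.exists_strong hf (c • φ).2).choose_spec ψ,
          (E.exists_strong hf φ.2).choose_spec ψ]
        exact E.formIntegral_smul_right c (φ.2 ψ) }

theorem inner_strongIntegral [CompleteSpace H] (E : POVM Ω H) (f : Ω → ℂ) (hf : Measurable f)
    (φ : (E.strongIntegral f hf).domain) (ψ : H) :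
    ⟪ψ, E.strongIntegral f hf φ⟫_ℂ = E.formIntegral f ψ φ :=
  (E.exists_strong hf φ.2).choose_spec ψ

/-- The `k`-th weak moment operator `E'[k] = L'(x^k, E)`. -/
def weakMoment [CompleteSpace H] (E : POVM ℝ H) (k : ℕ) : H →ₗ.[ℂ] H :=
  E.weakIntegral fun x => (x : ℂ) ^ k

/-- The `k`-th strong moment operator `E[k] = L(x^k, E)`. -/
def strongMoment [CompleteSpace H] (E : POVM ℝ H) (k : ℕ) : H →ₗ.[ℂ] H :=
  E.strongIntegral (fun x => (x : ℂ) ^ k) (by fun_prop)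

/-- The compression `X ↦ V* E(X) V` of a POVM. -/
def compress {K : Type*} [NormedAddCommGroup K] [InnerProductSpace ℂ K] [CompleteSpace K]
    [CompleteSpace H] (E : POVM Ω K) (V : H →L[ℂ] K) : POVM Ω H where
  op X := V.adjoint ∘L E.op X ∘L V
  isPositive X hX := (E.isPositive X hX).adjoint_conj V
  hasSum X hX hd φ := (E.hasSum X hX hd (V φ)).mapL V.adjoint

end POVM

/-! ### Unbounded operators -/

section Unbounded

variable {H K L : Type*} [AddCommGroup H] [Module ℂ H] [AddCommGroup K] [Module ℂ K]
  [AddCommGroup L] [Module ℂ L]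

/-- The product `S T` of partially defined operators, with domain `{φ ∈ dom T | T φ ∈ dom S}`. -/
def opMul (S : K →ₗ.[ℂ] L) (T : H →ₗ.[ℂ] K) : H →ₗ.[ℂ] L where
  domain := (S.domain.comap T.toFun).map T.domain.subtype
  toFun :=
    { toFun := fun φ => S ⟨T ⟨φ.1, by
          obtain ⟨y, _, hy⟩ := φ.2; rw [← hy]; exact y.2⟩, by
          obtain ⟨φ, y, hy, rfl⟩ := φ; exact hy⟩
      map_add' := fun φ φ' => by
        rw [← LinearPMap.map_add]
        exact congrArg S (Subtype.ext (LinearPMap.map_add T ⟨φ.1, _⟩ ⟨φ'.1, _⟩))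
      map_smul' := fun c φ => by
        rw [RingHom.id_apply, ← LinearPMap.map_smul]
        exact congrArg S (Subtype.ext (LinearPMap.map_smul T c ⟨φ.1, _⟩)) }

theorem mem_opMul_domain (S : K →ₗ.[ℂ] L) (T : H →ₗ.[ℂ] K) (φ : H) :
    φ ∈ (opMul S T).domain ↔ ∃ h : φ ∈ T.domain, T ⟨φ, h⟩ ∈ S.domain := by
  constructor
  · rintro ⟨y, hy, rfl⟩
    exact ⟨y.2, hy⟩
  · rintro ⟨h, h'⟩
    exact ⟨⟨φ, h⟩, h', rfl⟩

/-- The powers `T ^ n` of a partially defined operator, with `T ^ 0` the identity of the space. -/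
def opPow (T : H →ₗ.[ℂ] H) : ℕ → H →ₗ.[ℂ] H
  | 0 => LinearMap.id.toPMap ⊤
  | n + 1 => opMul T (opPow T n)

end Unbounded

/-! ### The momentum observable -/

/-- `L²(ℝ)`. -/
abbrev L2R : Type := Lp ℂ 2 (volume : Measure ℝ)

/-- `L²([0, ℓ])`. -/
abbrev L2I (ℓ : ℝ) : Type := Lp ℂ 2 ((volume : Measure ℝ).restrict (Icc 0 ℓ))

/-- Multiplication by the characteristic function of a measurable set in `L²(ℝ)`. -/
def indicatorMul (X : Set ℝ) (hX : MeasurableSet X) : L2R →L[ℂ] L2R :=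
  LinearMap.mkContinuous
    { toFun := fun ψ => ((Lp.memLp ψ).indicator hX).toLp (X.indicator ψ)
      map_add' := fun ψ ψ' => by
        rw [← MemLp.toLp_add, MemLp.toLp_eq_toLp_iff]
        filter_upwards [Lp.coeFn_add ψ ψ'] with x hx
        by_cases h : x ∈ X
        · simp only [indicator_of_mem h, hx, Pi.add_apply]
        · simp only [indicator_of_notMem h, Pi.add_apply, add_zero]
      map_smul' := fun c ψ => by
        rw [RingHom.id_apply, ← MemLp.toLp_const_smul, MemLp.toLp_eq_toLp_iff]
        filter_upwards [Lp.coeFn_smul c ψ] with x hx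
        by_cases h : x ∈ X <;> simp [h, hx] }
    1 fun ψ => by
      rw [one_mul]
      refine (Lp.norm_le_norm_of_ae_le ?_)
      filter_upwards [((Lp.memLp ψ).indicator hX).coeFn_toLp] with x hx
      simp only [LinearMap.coe_mk, AddHom.coe_mk]
      rw [hx]
      exact norm_indicator_le_norm_self _ _

theorem indicatorMul_coeFn (X : Set ℝ) (hX : MeasurableSet X) (ψ : L2R) :
    indicatorMul X hX ψ =ᵐ[volume] X.indicator ψ :=
  ((Lp.memLp ψ).indicator hX).coeFn_toLp

theorem inner_indicatorMul (X : Set ℝ) (hX : MeasurableSet X) (ψ φ : L2R) :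
    ⟪ψ, indicatorMul X hX φ⟫_ℂ = ∫ x in X, ⟪ψ x, φ x⟫_ℂ := by
  rw [L2.inner_def, ← integral_indicator hX]
  refine integral_congr_ae ?_
  filter_upwards [indicatorMul_coeFn X hX φ] with x hx
  rw [hx]
  by_cases h : x ∈ X <;> simp [h]

theorem indicatorMul_isPositive (X : Set ℝ) (hX : MeasurableSet X) :
    (indicatorMul X hX).IsPositive := by
  have key : ∀ φ : L2R, ⟪φ, indicatorMul X hX φ⟫_ℂ = ((∫ x in X, ‖φ x‖ ^ 2 : ℝ) : ℂ) := by
    intro φ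
    rw [inner_indicatorMul, ← integral_complex_ofReal]
    refine integral_congr_ae (Filter.Eventually.of_forall fun x => ?_)
    simp [inner_self_eq_norm_sq_to_K]
  rw [ContinuousLinearMap.isPositive_iff_complex]
  intro φ
  have h : ⟪indicatorMul X hX φ, φ⟫_ℂ = ((∫ x in X, ‖φ x‖ ^ 2 : ℝ) : ℂ) := by
    rw [← inner_conj_symm, key, Complex.conj_ofReal]
  rw [h]
  refine ⟨by simp, ?_⟩
  simp only [RCLike.re_to_complex, Complex.ofReal_re]
  positivity

theorem hasSum_indicatorMul (X : ℕ → Set ℝ) (hX : ∀ i, MeasurableSet (X i))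
    (hd : Pairwise (fun i j => Disjoint (X i) (X j))) (φ : L2R) :
    HasSum (fun i => indicatorMul (X i) (hX i) φ)
      (indicatorMul (⋃ i, X i) (MeasurableSet.iUnion hX) φ) := by
  have hn : ∀ (Y : Set ℝ) (hY : MeasurableSet Y),
      ‖indicatorMul Y hY φ‖ ^ 2 = ∫ x in Y, ‖φ x‖ ^ 2 := by
    intro Y hY
    rw [← integral_indicator hY, ← Complex.ofReal_inj, ← integral_complex_ofReal]
    rw [Complex.ofReal_pow]
    refine (inner_self_eq_norm_sq_to_K (𝕜 := ℂ) (indicatorMul Y hY φ)).symm.trans ?_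
    rw [L2.inner_def]
    refine integral_congr_ae ?_
    filter_upwards [indicatorMul_coeFn Y hY φ] with x hx
    rw [hx]
    by_cases h : x ∈ Y <;> simp [h, inner_self_eq_norm_sq_to_K]
  have hint : Integrable (fun x => ‖φ x‖ ^ 2) := (Lp.memLp φ).integrable_norm_pow (by norm_num)
  have hdiff : ∀ s : Finset ℕ, indicatorMul (⋃ i, X i) (MeasurableSet.iUnion hX) φ -
      ∑ i ∈ s, indicatorMul (X i) (hX i) φ =
      indicatorMul ((⋃ i, X i) \ ⋃ i ∈ s, X i)
        ((MeasurableSet.iUnion hX).diff (s.measurableSet_biUnion fun i _ => hX i)) φ := by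
    intro s
    refine ext_inner_left ℂ fun ψ => ?_
    have hi : Integrable (fun x => ⟪ψ x, φ x⟫_ℂ) := L2.integrable_inner ψ φ
    rw [inner_sub_right, inner_sum, inner_indicatorMul, inner_indicatorMul,
      setIntegral_sdiff (s.measurableSet_biUnion fun i _ => hX i) hi.integrableOn
        (iUnion₂_subset fun i _ => subset_iUnion X i),
      integral_biUnion_finset s (fun i _ => hX i) (fun i _ j _ hij => hd hij)
        (fun i _ => hi.integrableOn)]
    simp only [inner_indicatorMul]
  have hlim : Filter.Tendsto (fun s : Finset ℕ => ‖∑ i ∈ s, indicatorMul (X i) (hX i) φ -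
      indicatorMul (⋃ i, X i) (MeasurableSet.iUnion hX) φ‖ ^ 2) Filter.atTop (nhds 0) := by
    have h := hasSum_integral_iUnion hX hd hint.integrableOn
    rw [HasSum, SummationFilter.unconditional_filter] at h
    have h' := h.const_sub (∫ x in ⋃ i, X i, ‖φ x‖ ^ 2)
    rw [sub_self] at h'
    refine h'.congr fun s => ?_
    rw [norm_sub_rev, hdiff, hn,
      setIntegral_sdiff (s.measurableSet_biUnion fun i _ => hX i) hint.integrableOn
        (iUnion₂_subset fun i _ => subset_iUnion X i),
      integral_biUnion_finset s (fun i _ => hX i) (fun i _ j _ hij => hd hij)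
        (fun i _ => hint.integrableOn)]
  rw [HasSum, SummationFilter.unconditional_filter, tendsto_iff_norm_sub_tendsto_zero]
  have h2 := (Real.continuous_sqrt.tendsto 0).comp hlim
  simpa [Function.comp_def, Real.sqrt_sq] using h2

open scoped Classical in
/-- The sharp position observable `(Q(X) ψ)(x) = χ_X(x) ψ(x)` in `L²(ℝ)`. -/
def positionR : POVM ℝ L2R where
  op X := if hX : MeasurableSet X then indicatorMul X hX else 0
  isPositive X hX := by
    rw [dif_pos hX]
    exact indicatorMul_isPositive X hX
  hasSum X hX hd φ := by
    simpa only [hX, MeasurableSet.iUnion hX, dite_true] using hasSum_indicatorMul X hX hd φ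

theorem map_dilation : Measure.map (fun x : ℝ => x * (2 * Real.pi)⁻¹) volume =
    ENNReal.ofReal |((2 * Real.pi)⁻¹)⁻¹| • volume :=
  Real.map_volume_mul_right (by positivity)

theorem quasi_dilation : Measure.QuasiMeasurePreserving (fun x : ℝ => x * (2 * Real.pi)⁻¹)
    volume volume :=
  ⟨by fun_prop, by rw [map_dilation]; exact Measure.smul_absolutelyContinuous⟩

theorem eLpNorm_dilation (g : L2R) :
    eLpNorm (fun x => (((Real.sqrt (2 * Real.pi))⁻¹ : ℝ) : ℂ) * g (x * (2 * Real.pi)⁻¹)) 2 volume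
      = eLpNorm g 2 volume := by
  have hm : AEStronglyMeasurable g (Measure.map (fun x : ℝ => x * (2 * Real.pi)⁻¹) volume) :=
    (Lp.aestronglyMeasurable g).mono_ac quasi_dilation.2
  have h := eLpNorm_map_measure (p := 2) hm (by fun_prop)
  rw [map_dilation, eLpNorm_smul_measure_of_ne_top (by norm_num)] at h
  have h1 : (fun x => (((Real.sqrt (2 * Real.pi))⁻¹ : ℝ) : ℂ) * g (x * (2 * Real.pi)⁻¹)) =
      (((Real.sqrt (2 * Real.pi))⁻¹ : ℝ) : ℂ) • (g ∘ fun x : ℝ => x * (2 * Real.pi)⁻¹) := rfl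
  have hp : (0 : ℝ) < 2 * Real.pi := by positivity
  rw [h1, eLpNorm_const_smul, ← h, smul_eq_mul, ← mul_assoc, inv_inv, abs_of_pos hp,
    ← ofReal_norm, Complex.norm_real, Real.norm_of_nonneg (by positivity),
    ENNReal.ofReal_rpow_of_pos hp, ← ENNReal.ofReal_mul (by positivity)]
  have h2 : (Real.sqrt (2 * Real.pi))⁻¹ * (2 * Real.pi) ^ (1 / (2 : ℝ≥0∞)).toReal = 1 := by
    have : (1 / (2 : ℝ≥0∞)).toReal = 1 / 2 := by simp
    rw [this, ← Real.sqrt_eq_rpow, inv_mul_cancel₀ (Real.sqrt_pos.2 hp).ne']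
  rw [h2, ENNReal.ofReal_one, one_mul]

theorem memLp_dilation (g : L2R) :
    MemLp (fun x => (((Real.sqrt (2 * Real.pi))⁻¹ : ℝ) : ℂ) * g (x * (2 * Real.pi)⁻¹)) 2 volume := by
  refine ⟨?_, by rw [eLpNorm_dilation]; exact (Lp.memLp g).2⟩
  exact ((Lp.aestronglyMeasurable g).comp_quasiMeasurePreserving quasi_dilation).const_mul _

/-- The dilation `(D g)(x) = (2π)^{-1/2} g(x / 2π)` in `L²(ℝ)`. -/
def dilation : L2R →L[ℂ] L2R :=
  LinearMap.mkContinuous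
    { toFun := fun g => (memLp_dilation g).toLp _
      map_add' := fun g h => by
        rw [← MemLp.toLp_add, MemLp.toLp_eq_toLp_iff]
        filter_upwards [quasi_dilation.ae (Lp.coeFn_add g h)] with x hx
        simp only [hx, Pi.add_apply, mul_add]
      map_smul' := fun c g => by
        rw [RingHom.id_apply, ← MemLp.toLp_const_smul, MemLp.toLp_eq_toLp_iff]
        filter_upwards [quasi_dilation.ae (Lp.coeFn_smul c g)] with x hx
        simp only [hx, Pi.smul_apply, smul_eq_mul]
        ring }
    1 fun g => by
      rw [one_mul]
      simp only [LinearMap.coe_mk, AddHom.coe_mk]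
      rw [Lp.norm_toLp, eLpNorm_dilation, ← Lp.norm_def]

theorem dilation_coeFn (g : L2R) : dilation g =ᵐ[volume]
    fun x => (((Real.sqrt (2 * Real.pi))⁻¹ : ℝ) : ℂ) * g (x * (2 * Real.pi)⁻¹) := by
  rw [dilation, LinearMap.mkContinuous_apply, LinearMap.coe_mk, AddHom.coe_mk]
  exact MemLp.coeFn_toLp _

/-- The Fourier-Plancherel operator of `L²(ℝ)` normalized by
`(F ψ)(x) = (2π)^{-1/2} ∫ exp(-ixt) ψ(t) dt`. -/
def fourierPlancherel : L2R →L[ℂ] L2R :=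
  dilation ∘L (Lp.fourierTransformₗᵢ ℝ ℂ).toContinuousLinearEquiv.toContinuousLinearMap

theorem fourierPlancherel_schwartz (ψ : SchwartzMap ℝ ℂ) :
    fourierPlancherel (ψ.toLp 2) =ᵐ[volume] fun x =>
      (((Real.sqrt (2 * Real.pi))⁻¹ : ℝ) : ℂ) * ∫ t : ℝ, Complex.exp (-Complex.I * x * t) * ψ t := by
  have h1 : fourierPlancherel (ψ.toLp 2) = dilation ((FourierTransform.fourier ψ).toLp 2) := by
    rw [fourierPlancherel, ContinuousLinearMap.comp_apply]
    exact congrArg dilation (SchwartzMap.toLp_fourier_eq ψ)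
  rw [h1]
  refine (dilation_coeFn _).trans ?_
  filter_upwards [quasi_dilation.ae ((FourierTransform.fourier ψ).coeFn_toLp 2 volume)] with x hx
  rw [hx, SchwartzMap.fourier_coe, Real.fourier_eq']
  congr 1
  refine integral_congr_ae (Filter.Eventually.of_forall fun t => ?_)
  have hp : (Real.pi : ℂ) ≠ 0 := by exact_mod_cast Real.pi_ne_zero
  simp only [smul_eq_mul]
  congr 2
  simp
  field_simp

/-- The sharp momentum observable `P_ℝ(Y) = F* Q_ℝ(Y) F`. -/
def momentumR : POVM ℝ L2R := positionR.compress fourierPlancherel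

/-- The isometry `U : L²([0, ℓ]) → L²(ℝ)`, extension by zero. -/
def extendZero (ℓ : ℝ) : L2I ℓ →L[ℂ] L2R :=
  LinearMap.mkContinuous
    { toFun := fun ψ => ((memLp_indicator_iff_restrict measurableSet_Icc).2
        (Lp.memLp ψ)).toLp ((Icc 0 ℓ).indicator ψ)
      map_add' := fun ψ ψ' => by
        rw [← MemLp.toLp_add, MemLp.toLp_eq_toLp_iff]
        filter_upwards [(ae_restrict_iff' measurableSet_Icc).1 (Lp.coeFn_add ψ ψ')] with x hx
        by_cases h : x ∈ Icc 0 ℓ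
        · simp only [indicator_of_mem h, hx h, Pi.add_apply]
        · simp only [indicator_of_notMem h, Pi.add_apply, add_zero]
      map_smul' := fun c ψ => by
        rw [RingHom.id_apply, ← MemLp.toLp_const_smul, MemLp.toLp_eq_toLp_iff]
        filter_upwards [(ae_restrict_iff' measurableSet_Icc).1 (Lp.coeFn_smul c ψ)] with x hx
        by_cases h : x ∈ Icc 0 ℓ
        · simp only [indicator_of_mem h, hx h, Pi.smul_apply]
        · simp only [indicator_of_notMem h, Pi.smul_apply, smul_zero] }
    1 fun ψ => by
      rw [one_mul]
      simp only [LinearMap.coe_mk, AddHom.coe_mk]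
      rw [Lp.norm_toLp, eLpNorm_indicator_eq_eLpNorm_restrict measurableSet_Icc, ← Lp.norm_def]

/-- The momentum observable of a particle confined to `[0, ℓ]`: the truncation
`P(Y) = U* P_ℝ(Y) U`. -/
def truncatedMomentum (ℓ : ℝ) : POVM ℝ (L2I ℓ) := momentumR.compress (extendZero ℓ)

/-! ### Differential operators on the interval -/

/-- `u` is a representative of an element of the Sobolev space `H^n([0, ℓ])` (`L²` for `n = 0`)
with `n`-th derivative `g`: for `n = m + 1` this says that `u` is `m` times continuously
differentiable on `[0, ℓ]`, that `u^(m)` is absolutely continuous, and that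
`g ∈ L²` is almost everywhere the derivative of `u^(m)`. -/
def IsSobolev (ℓ : ℝ) : ℕ → (ℝ → ℂ) → L2I ℓ → Prop
  | 0, u, g => g =ᵐ[volume.restrict (Icc 0 ℓ)] u
  | m + 1, u, g =>
    ContDiffOn ℝ m u (Icc 0 ℓ) ∧
      AbsolutelyContinuousOnInterval (iteratedDerivWithin m u (Icc 0 ℓ)) 0 ℓ ∧
      ∀ᵐ x ∂volume.restrict (Icc 0 ℓ),
        HasDerivWithinAt (iteratedDerivWithin m u (Icc 0 ℓ)) (g x) (Icc 0 ℓ) x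

theorem ac_congr {f g : ℝ → ℂ} {a b : ℝ} (h : EqOn f g (uIcc a b))
    (hf : AbsolutelyContinuousOnInterval f a b) : AbsolutelyContinuousOnInterval g a b := by
  rw [absolutelyContinuousOnInterval_iff] at *
  intro ε hε
  obtain ⟨δ, hδ, H⟩ := hf ε hε
  refine ⟨δ, hδ, fun E hE hs => ?_⟩
  have := H E hE hs
  convert this using 1
  refine Finset.sum_congr rfl fun i hi => ?_
  have hi' := hE.1 i hi
  rw [h hi'.1, h hi'.2]

theorem IsSobolev.add {ℓ : ℝ} (hℓ : 0 < ℓ) {n : ℕ} {u v : ℝ → ℂ} {g h : L2I ℓ}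
    (hu : IsSobolev ℓ n u g) (hv : IsSobolev ℓ n v h) : IsSobolev ℓ n (u + v) (g + h) := by
  cases n with
  | zero =>
    change _ =ᵐ[_] _ at hu
    change _ =ᵐ[_] _ at hv
    exact (Lp.coeFn_add g h).trans (hu.add hv)
  | succ m =>
    obtain ⟨hu1, hu2, hu3⟩ := hu
    obtain ⟨hv1, hv2, hv3⟩ := hv
    have he : EqOn (iteratedDerivWithin m u (Icc 0 ℓ) + iteratedDerivWithin m v (Icc 0 ℓ))
        (iteratedDerivWithin m (u + v) (Icc 0 ℓ)) (Icc 0 ℓ) := fun x hx =>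
      (iteratedDerivWithin_add hx (uniqueDiffOn_Icc hℓ) (hu1 x hx) (hv1 x hx)).symm
    refine ⟨hu1.add hv1, ac_congr (by rwa [uIcc_of_le hℓ.le]) (hu2.add hv2), ?_⟩
    filter_upwards [hu3, hv3, Lp.coeFn_add g h, ae_restrict_mem measurableSet_Icc]
      with x h1 h2 h3 hx
    rw [h3]
    exact (h1.add h2).congr (fun y hy => (he hy).symm) (he hx).symm

theorem IsSobolev.smul {ℓ : ℝ} {n : ℕ} {u : ℝ → ℂ} {g : L2I ℓ} (c : ℂ)
    (hu : IsSobolev ℓ n u g) : IsSobolev ℓ n (c • u) (c • g) := by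
  cases n with
  | zero =>
    change _ =ᵐ[_] _ at hu
    exact (Lp.coeFn_smul c g).trans (hu.const_smul c)
  | succ m =>
    obtain ⟨hu1, hu2, hu3⟩ := hu
    have he : iteratedDerivWithin m (c • u) (Icc 0 ℓ) =
        c • iteratedDerivWithin m u (Icc 0 ℓ) := by
      ext x
      exact iteratedDerivWithin_const_smul_field c u
    refine ⟨hu1.const_smul c, by rw [he]; exact hu2.const_smul c, ?_⟩
    filter_upwards [hu3, Lp.coeFn_smul c g] with x h1 h3
    rw [h3, he]
    exact h1.const_smul c

theorem IsSobolev.zero (ℓ : ℝ) (n : ℕ) : IsSobolev ℓ n 0 0 := by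
  cases n with
  | zero => exact Lp.coeFn_zero _ _ _
  | succ m =>
    have he : iteratedDerivWithin m (0 : ℝ → ℂ) (Icc 0 ℓ) = 0 := by
      have h := fun x => iteratedDerivWithin_const_smul_field (n := m) (s := Icc 0 ℓ) (x := x)
        (0 : ℂ) (0 : ℝ → ℂ)
      ext x
      simpa using h x
    refine ⟨contDiffOn_const, ?_, ?_⟩
    · rw [he]
      simp [AbsolutelyContinuousOnInterval, tendsto_const_nhds]
    · filter_upwards [Lp.coeFn_zero ℂ 2 ((volume : Measure ℝ).restrict (Icc 0 ℓ))] with x hx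
      rw [he, hx]
      exact hasDerivWithinAt_const x _ (0 : ℂ)

/-- If a Sobolev function vanishes almost everywhere, so does its `n`-th derivative. -/
theorem IsSobolev.unique {ℓ : ℝ} (hℓ : 0 < ℓ) {n : ℕ} {u : ℝ → ℂ} {g : L2I ℓ}
    (hu : IsSobolev ℓ n u g) (h0 : u =ᵐ[volume.restrict (Icc 0 ℓ)] 0) : g = 0 := by
  rw [Lp.eq_zero_iff_ae_eq_zero]
  cases n with
  | zero => exact Filter.EventuallyEq.trans hu h0
  | succ m =>
    obtain ⟨hu1, -, hu3⟩ := hu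
    have he : EqOn u 0 (Icc 0 ℓ) :=
      Measure.eqOn_Icc_of_ae_eq volume hℓ.ne h0 hu1.continuousOn continuousOn_const
    have he' : EqOn (iteratedDerivWithin m u (Icc 0 ℓ)) 0 (Icc 0 ℓ) := fun x hx => by
      rw [iteratedDerivWithin_congr he hx]
      have h := iteratedDerivWithin_const_smul_field (n := m) (s := Icc 0 ℓ) (x := x)
        (0 : ℂ) (0 : ℝ → ℂ)
      simpa using h
    filter_upwards [hu3, ae_restrict_mem measurableSet_Icc] with x h1 hx
    have h2 : HasDerivWithinAt (iteratedDerivWithin m u (Icc 0 ℓ)) 0 (Icc 0 ℓ) x :=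
      (hasDerivWithinAt_const x _ (0 : ℂ)).congr he' (he' hx)
    exact (uniqueDiffOn_Icc hℓ x hx).eq_deriv _ h1 h2

/-- The graph of the operator `c (d/dx)^n` on the space of all `φ ∈ H^n([0, ℓ])` with
`φ^(k)(0) = φ^(k)(ℓ) = 0` for `k = 0, …, r - 1`, where `r ≤ n`. -/
def diffGraph {ℓ : ℝ} (hℓ : 0 < ℓ) (c : ℂ) {n r : ℕ} (hr : r ≤ n) :
    Submodule ℂ (L2I ℓ × L2I ℓ) where
  carrier := {p | ∃ (u : ℝ → ℂ) (g : L2I ℓ), IsSobolev ℓ n u g ∧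
    p.1 =ᵐ[volume.restrict (Icc 0 ℓ)] u ∧
    (∀ k < r, iteratedDerivWithin k u (Icc 0 ℓ) 0 = 0 ∧ iteratedDerivWithin k u (Icc 0 ℓ) ℓ = 0) ∧
    p.2 = c • g}
  zero_mem' := ⟨0, 0, IsSobolev.zero ℓ n, Lp.coeFn_zero _ _ _, fun k _ => by simp, by simp⟩
  add_mem' := by
    rintro p q ⟨u, g, hu, hpu, hub, hpg⟩ ⟨v, h, hv, hqv, hvb, hqh⟩
    refine ⟨u + v, g + h, hu.add hℓ hv, (Lp.coeFn_add p.1 q.1).trans (hpu.add hqv), ?_, ?_⟩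
    · intro k hk
      obtain ⟨m, rfl⟩ : ∃ m, n = m + 1 := ⟨n - 1, by omega⟩
      have hkm : ((k : ℕ) : WithTop ℕ∞) ≤ (m : ℕ) := by exact_mod_cast (by omega : k ≤ m)
      have key : ∀ x ∈ Icc 0 ℓ, iteratedDerivWithin k (u + v) (Icc 0 ℓ) x =
          iteratedDerivWithin k u (Icc 0 ℓ) x + iteratedDerivWithin k v (Icc 0 ℓ) x := fun x hx =>
        iteratedDerivWithin_add hx (uniqueDiffOn_Icc hℓ) ((hu.1 x hx).of_le hkm)
          ((hv.1 x hx).of_le hkm)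
      rw [key 0 ⟨le_rfl, hℓ.le⟩, key ℓ ⟨hℓ.le, le_rfl⟩, (hub k hk).1, (hub k hk).2, (hvb k hk).1,
        (hvb k hk).2]
      simp
    · rw [Prod.snd_add, hpg, hqh, smul_add]
  smul_mem' := by
    rintro a p ⟨u, g, hu, hpu, hub, hpg⟩
    refine ⟨a • u, a • g, hu.smul a, (Lp.coeFn_smul a p.1).trans (hpu.const_smul a), ?_, ?_⟩
    · intro k hk
      rw [iteratedDerivWithin_const_smul_field, iteratedDerivWithin_const_smul_field,
        (hub k hk).1, (hub k hk).2]
      simp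
    · rw [Prod.smul_snd, hpg, smul_comm]

/-- The operator `c (d/dx)^n` in `L²([0, ℓ])` with domain the space of all `φ ∈ H^n([0, ℓ])` such
that `φ^(k)(0) = φ^(k)(ℓ) = 0` for `k = 0, …, r - 1`, where `r ≤ n`. -/
def diffOp {ℓ : ℝ} (hℓ : 0 < ℓ) (c : ℂ) {n r : ℕ} (hr : r ≤ n) : L2I ℓ →ₗ.[ℂ] L2I ℓ :=
  (diffGraph hℓ c hr).toLinearPMap

theorem diffOp_graph {ℓ : ℝ} (hℓ : 0 < ℓ) (c : ℂ) {n r : ℕ} (hr : r ≤ n) :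
    (diffOp hℓ c hr).graph = diffGraph hℓ c hr := by
  refine Submodule.toLinearPMap_graph_eq _ ?_
  rintro ⟨φ, η⟩ ⟨u, g, hu, hpu, -, hpg⟩ h0
  simp only at h0 hpu hpg
  subst h0
  rw [hpg, hu.unique hℓ (hpu.symm.trans (Lp.coeFn_zero _ _ _)), smul_zero]

/-- The operator `(-i d/dx)^n` in `L²([0, ℓ])` with domain the space of all `φ ∈ H^n([0, ℓ])` such
that `φ^(k)(0) = φ^(k)(ℓ) = 0` for `k = 0, …, r - 1`, where `r ≤ n`. -/
def momentumOp {ℓ : ℝ} (hℓ : 0 < ℓ) {n r : ℕ} (hr : r ≤ n) : L2I ℓ →ₗ.[ℂ] L2I ℓ :=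
  diffOp hℓ ((-Complex.I) ^ n) hr

/-- The operator `P₀ = -i d/dx` on the absolutely continuous functions `φ` on `[0, ℓ]` with
`φ' ∈ L²` and `φ(0) = φ(ℓ) = 0`. -/
def minimalMomentum {ℓ : ℝ} (hℓ : 0 < ℓ) : L2I ℓ →ₗ.[ℂ] L2I ℓ := momentumOp hℓ (le_refl 1)

/-- The Dirichlet Hamiltonian `-(2m)⁻¹ d²/dx²` of a particle of mass `m` in the box `[0, ℓ]`
(in units with `ħ = 1`), on the functions `φ ∈ H²([0, ℓ])` with `φ(0) = φ(ℓ) = 0`. -/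
def boxHamiltonian {ℓ : ℝ} (hℓ : 0 < ℓ) (m : ℝ) : L2I ℓ →ₗ.[ℂ] L2I ℓ :=
  diffOp hℓ (-(2 * (m : ℂ))⁻¹) (one_le_two : 1 ≤ 2)

end

/-! Write `W = F U` (`boxFourier`). The measure `P_{ψ,φ}` has the density `conj (W ψ) * W φ`, so
every moment is an integral `∫ x^k conj(Wψ) Wφ dx`. All equalities of operators are proved as
equalities of graphs.

Strong moments. For `φ` in `dom P₀^k` the boundary terms of partial integration vanish and `W P₀^k φ
= x^k W φ`, which gives one inclusion. For the other, let `k = 1`. Testing with `ψ = e^t`, whose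
transform decays no faster than `1/|x|`, shows that `W φ` is integrable. By Fourier inversion the
zero extension of `φ` then agrees a.e. with a continuous function; it vanishes outside `[0, ℓ]`,
hence at both endpoints. Testing with step functions identifies it as a primitive, so `φ ∈ dom P₀`
(`mem_graph_minimalMomentum_of_integrable`). Induction on `k` gives `P[k] = P₀^k`.

Even weak moments. `∫ x^(2n) |Wφ|² < ∞` means `x^n Wφ ∈ L²`, so the form domain is `dom P₀^n` by the
strong case, and the form is `⟪P₀^n ψ, P₀^n φ⟫`. The weak moment is then `(P₀^n)* P₀^n` by the
definition of the adjoint. The adjoint is the maximal operator `(-i d/dx)^n`: the range of `P₀^n`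
contains everything orthogonal to the polynomials of degree `< n`, a finite dimensional space.
Composing gives exactly `n` boundary conditions at each end.

First weak moment. `D_1` is defined by `∫ |x| |Wφ|² < ∞` and is not handled through `dom P₀`.
Testing on `dom P₀` only gives `φ ∈ dom P₀*`, with endpoint values `C` and `D`, and partial
integration gives `x Wφ - Wη = i (2π)^(-1/2) (D e^(-ixℓ) - C)`. Membership in `D_1` makes `|D
e^(-ixℓ) - C|² / x` integrable at infinity, which forces `C = D = 0`
(`eq_zero_of_integrable_boundary`). -/

/-! ### Complex measures with a density -/

section Density

variable {Ω : Type*} [MeasurableSpace Ω] {μ : Measure Ω}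

theorem integrable_withDensityᵥ_iff {h f : Ω → ℂ} (hh : Integrable h μ) (hf : Measurable f) :
    (μ.withDensityᵥ h).Integrable f ↔ Integrable (fun x => f x * h x) μ := by
  rw [VectorMeasure.Integrable, Measure.variation_withDensityᵥ hh,
    integrable_withDensity_iff_integrable_smul₀' hh.aestronglyMeasurable.enorm
      (Filter.Eventually.of_forall fun x => enorm_lt_top)]
  have hm : AEStronglyMeasurable f μ := hf.aestronglyMeasurable
  refine integrable_congr' ?_ (hm.mul hh.aestronglyMeasurable)
    (Filter.Eventually.of_forall fun x => ?_)
  · exact (hh.aestronglyMeasurable.enorm.ennreal_toReal.aestronglyMeasurable).smul hm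
  · simp [mul_comm]

theorem integrable_mul_of_integrable_withDensityᵥ {h f : Ω → ℂ} (hh : Integrable h μ)
    (hf : (μ.withDensityᵥ h).Integrable f) : Integrable (fun x => f x * h x) μ := by
  rw [VectorMeasure.Integrable, Measure.variation_withDensityᵥ hh] at hf
  obtain ⟨g, hg, hfg⟩ := hf.aestronglyMeasurable
  have h1 := (integrable_withDensityᵥ_iff hh hg.measurable).1
    (by rw [VectorMeasure.Integrable, Measure.variation_withDensityᵥ hh]; exact hf.congr hfg)
  refine h1.congr ?_
  -- Equality a.e. for `|h| μ` says nothing where `h = 0`, but there both products vanish.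
  filter_upwards [(ae_withDensity_iff' hh.aestronglyMeasurable.enorm).1 hfg] with x hx
  by_cases h0 : h x = 0
  · simp [h0]
  · rw [hx (by simpa using h0)]

theorem lintegral_enorm_mul_withDensityᵥ {h f : Ω → ℂ} (hh : Integrable h μ)
    (hf : (μ.withDensityᵥ h).Integrable f) :
    ∫⁻ x, ‖f x * h x‖ₑ ∂μ = ∫⁻ x, ‖f x‖ₑ ∂(μ.withDensityᵥ h).variation := by
  rw [VectorMeasure.Integrable, Measure.variation_withDensityᵥ hh] at hf
  rw [Measure.variation_withDensityᵥ hh, lintegral_withDensity_eq_lintegral_mul₀'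
    hh.aestronglyMeasurable.enorm hf.aestronglyMeasurable.enorm]
  simp [enorm_mul, mul_comm]

theorem integral_withDensityᵥ {h f : Ω → ℂ} (hh : Integrable h μ)
    (hi : (μ.withDensityᵥ h).Integrable f) :
    ∫ᵛ x, f x ∂[ContinuousLinearMap.mul ℝ ℂ; μ.withDensityᵥ h] = ∫ x, f x * h x ∂μ := by
  have hT := dominatedFinMeasAdditive_cbmApplyMeasure (μ.withDensityᵥ h)
    (ContinuousLinearMap.mul ℝ ℂ)
  refine Integrable.induction
    (fun f => setToFun (μ.withDensityᵥ h).variation _ hT f = ∫ x, f x * h x ∂μ) ?_ ?_ ?_ ?_ hi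
  · intro c s hs hfin
    rw [setToFun_indicator_const hT hs hfin.ne, transpose_eq_cbmApplyMeasure,
      cbmApplyMeasure_apply, withDensityᵥ_apply hh hs, ContinuousLinearMap.mul_apply',
      ← integral_const_mul, ← integral_indicator hs]
    refine integral_congr_ae (Filter.Eventually.of_forall fun x => ?_)
    by_cases hx : x ∈ s <;> simp [hx]
  · intro f g _ hf hg h1 h2
    have e : ∀ x, (f + g) x * h x = f x * h x + g x * h x := fun x => by
      simp [add_mul]
    simp only [e]
    rw [setToFun_add hT hf hg, h1, h2, integral_add
      (integrable_mul_of_integrable_withDensityᵥ hh hf)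
      (integrable_mul_of_integrable_withDensityᵥ hh hg)]
  -- `f ↦ ∫ f h dμ` is 1-Lipschitz on `L¹` of the variation because the variation is `|h| μ`.
  · refine isClosed_eq (continuous_setToFun hT) (LipschitzWith.continuous (K := 1) ?_)
    refine fun f g => ?_
    have hf := integrable_mul_of_integrable_withDensityᵥ hh (L1.integrable_coeFn f)
    have hg := integrable_mul_of_integrable_withDensityᵥ hh (L1.integrable_coeFn g)
    rw [edist_eq_enorm_sub, ← integral_sub hf hg, ENNReal.coe_one, one_mul, L1.edist_def]
    refine (enorm_integral_le_lintegral_enorm _).trans ?_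
    refine le_of_eq ?_
    simp only [← sub_mul]
    exact (lintegral_enorm_mul_withDensityᵥ (f := fun x => f x - g x) hh
      ((L1.integrable_coeFn f).sub (L1.integrable_coeFn g))).trans (by simp [edist_eq_enorm_sub])
  · intro f g hfg hf h1
    rw [← setToFun_congr_ae hT hfg, h1]
    rw [Measure.variation_withDensityᵥ hh] at hfg
    refine integral_congr_ae ?_
    filter_upwards [(ae_withDensity_iff' hh.aestronglyMeasurable.enorm).1 hfg] with x hx
    by_cases h0 : h x = 0
    · simp [h0]
    · rw [hx (by simpa using h0)]

end Density

/-! ### Graphs of operator integrals and of products -/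

namespace POVM

variable {Ω : Type*} [MeasurableSpace Ω] {H : Type*} [NormedAddCommGroup H]
  [InnerProductSpace ℂ H]

theorem strongDomain_le_formDomain (E : POVM Ω H) (f : Ω → ℂ) :
    E.strongDomain f ≤ E.formDomain f := fun φ h => h φ

variable [CompleteSpace H]

/-- The continuity condition disappears: a representing vector `η` makes the functional continuous,
and density of the form domain makes `η` unique. -/
theorem mem_graph_weakIntegral_iff (E : POVM Ω H) {f : Ω → ℂ}
    (hD : Dense (E.formDomain f : Set H)) {φ η : H} :
    (φ, η) ∈ (E.weakIntegral f).graph ↔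
      φ ∈ E.formDomain f ∧ ∀ ψ ∈ E.formDomain f, ⟪ψ, η⟫_ℂ = E.formIntegral f ψ φ := by
  constructor
  · intro h
    obtain ⟨φ', rfl, rfl⟩ := (LinearPMap.mem_graph_iff _).1 h
    exact ⟨φ'.2.1, fun ψ hψ => E.inner_weakIntegral f hD φ' hψ⟩
  · rintro ⟨hφ, h⟩
    have hw : φ ∈ E.weakDomain f := by
      refine ⟨hφ, ?_⟩
      have : Continuous fun ψ : E.formDomain f => ⟪(ψ : H), η⟫_ℂ := by fun_prop
      exact this.congr fun ψ => h ψ ψ.2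
    refine (LinearPMap.mem_graph_iff _).2 ⟨⟨φ, hw⟩, rfl, ?_⟩
    refine hD.eq_of_inner_right ℂ fun ψ hψ => ?_
    rw [E.inner_weakIntegral f hD ⟨φ, hw⟩ hψ, h ψ hψ]

theorem mem_graph_strongIntegral_iff (E : POVM Ω H) {f : Ω → ℂ} (hf : Measurable f) {φ η : H} :
    (φ, η) ∈ (E.strongIntegral f hf).graph ↔
      φ ∈ E.strongDomain f ∧ ∀ ψ, ⟪ψ, η⟫_ℂ = E.formIntegral f ψ φ := by
  constructor
  · intro h
    obtain ⟨φ', rfl, rfl⟩ := (LinearPMap.mem_graph_iff _).1 h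
    exact ⟨φ'.2, fun ψ => E.inner_strongIntegral f hf φ' ψ⟩
  · rintro ⟨hφ, h⟩
    refine (LinearPMap.mem_graph_iff _).2 ⟨⟨φ, hφ⟩, rfl, ext_inner_left ℂ fun ψ => ?_⟩
    rw [E.inner_strongIntegral f hf ⟨φ, hφ⟩, h ψ]

end POVM

section Unbounded

variable {H K L : Type*} [AddCommGroup H] [Module ℂ H] [AddCommGroup K] [Module ℂ K]
  [AddCommGroup L] [Module ℂ L]

theorem mem_graph_opMul_iff (S : K →ₗ.[ℂ] L) (T : H →ₗ.[ℂ] K) {φ : H} {η : L} :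
    (φ, η) ∈ (opMul S T).graph ↔ ∃ θ, (φ, θ) ∈ T.graph ∧ (θ, η) ∈ S.graph := by
  constructor
  · intro h
    obtain ⟨φ', rfl, rfl⟩ := (LinearPMap.mem_graph_iff _).1 h
    obtain ⟨h1, h2⟩ := (mem_opMul_domain S T _).1 φ'.2
    exact ⟨T ⟨φ', h1⟩, LinearPMap.mem_graph T ⟨φ', h1⟩, LinearPMap.mem_graph S ⟨_, h2⟩⟩
  · rintro ⟨θ, h1, h2⟩
    obtain ⟨φ', rfl, rfl⟩ := (LinearPMap.mem_graph_iff _).1 h1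
    obtain ⟨θ', h3, rfl⟩ := (LinearPMap.mem_graph_iff _).1 h2
    have hS : T φ' ∈ S.domain := by
      have := θ'.2
      rwa [h3] at this
    have hd : (φ' : H) ∈ (opMul S T).domain := (mem_opMul_domain S T _).2 ⟨φ'.2, hS⟩
    refine (LinearPMap.mem_graph_iff _).2 ⟨⟨φ', hd⟩, rfl, ?_⟩
    exact congrArg S (Subtype.ext h3.symm)

theorem mem_graph_opPow_zero_iff (T : H →ₗ.[ℂ] H) {φ η : H} :
    (φ, η) ∈ (opPow T 0).graph ↔ φ = η := by
  rw [LinearPMap.mem_graph_iff]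
  constructor
  · rintro ⟨y, rfl, rfl⟩
    rfl
  · rintro rfl
    exact ⟨⟨φ, trivial⟩, rfl, rfl⟩

theorem mem_graph_opPow_succ_iff (T : H →ₗ.[ℂ] H) {n : ℕ} {φ η : H} :
    (φ, η) ∈ (opPow T (n + 1)).graph ↔ ∃ θ, (φ, θ) ∈ (opPow T n).graph ∧ (θ, η) ∈ T.graph :=
  mem_graph_opMul_iff T (opPow T n)

/-- `opPow` adds factors on the left; here the innermost one is split off, which matches the way
differential operators are decomposed in `mem_graph_momentumOp_succ_iff`. -/
theorem mem_graph_opPow_succ_iff' (T : H →ₗ.[ℂ] H) {n : ℕ} {φ η : H} :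
    (φ, η) ∈ (opPow T (n + 1)).graph ↔ ∃ θ, (φ, θ) ∈ T.graph ∧ (θ, η) ∈ (opPow T n).graph := by
  induction n generalizing η with
  | zero =>
    rw [mem_graph_opPow_succ_iff]
    simp only [mem_graph_opPow_zero_iff, exists_eq_left', exists_eq_right]
  | succ n ih =>
    rw [mem_graph_opPow_succ_iff]
    constructor
    · rintro ⟨θ, h, h3⟩
      obtain ⟨ξ, h1, h2⟩ := ih.1 h
      exact ⟨ξ, h1, (mem_graph_opPow_succ_iff T).2 ⟨θ, h2, h3⟩⟩
    · rintro ⟨ξ, h1, h⟩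
      obtain ⟨θ, h2, h3⟩ := (mem_graph_opPow_succ_iff T).1 h
      exact ⟨θ, ih.2 ⟨ξ, h1, h2⟩, h3⟩

theorem opPow_one (T : H →ₗ.[ℂ] H) : opPow T 1 = T := by
  refine LinearPMap.eq_of_eq_graph ?_
  ext ⟨φ, η⟩
  rw [mem_graph_opPow_succ_iff]
  simp only [mem_graph_opPow_zero_iff, exists_eq_left']

end Unbounded

/-! ### Absolutely continuous functions -/

section AC

theorem AbsolutelyContinuousOnInterval.ofReal {f : ℝ → ℝ} {a b : ℝ}
    (hf : AbsolutelyContinuousOnInterval f a b) :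
    AbsolutelyContinuousOnInterval (fun x => (f x : ℂ)) a b := by
  simpa [AbsolutelyContinuousOnInterval, Complex.isometry_ofReal.dist_eq] using hf

theorem AbsolutelyContinuousOnInterval.conj {f : ℝ → ℂ} {a b : ℝ}
    (hf : AbsolutelyContinuousOnInterval f a b) :
    AbsolutelyContinuousOnInterval (fun x => starRingEnd ℂ (f x)) a b := by
  simpa [AbsolutelyContinuousOnInterval, Complex.dist_conj_conj] using hf

theorem absolutelyContinuousOnInterval_primitive {g : ℝ → ℂ} {a b : ℝ}
    (hg : IntervalIntegrable g volume a b) :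
    AbsolutelyContinuousOnInterval (fun x => ∫ t in a..x, g t) a b := by
  have hre : IntervalIntegrable (fun t => (g t).re) volume a b := ⟨hg.1.re, hg.2.re⟩
  have him : IntervalIntegrable (fun t => (g t).im) volume a b := ⟨hg.1.im, hg.2.im⟩
  have h := (hre.absolutelyContinuousOnInterval_intervalIntegral left_mem_uIcc).ofReal.add
    ((him.absolutelyContinuousOnInterval_intervalIntegral left_mem_uIcc).ofReal.const_smul
      Complex.I)
  refine ac_congr (fun x hx => ?_) h
  have hx' : IntervalIntegrable g volume a x := hg.mono_set (uIcc_subset_uIcc left_mem_uIcc hx)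
  have h1 := Complex.reCLM.intervalIntegral_comp_comm hx'
  have h2 := Complex.imCLM.intervalIntegral_comp_comm hx'
  simp only [Complex.reCLM_apply, Complex.imCLM_apply] at h1 h2
  simp only [Pi.add_apply, smul_eq_mul, h1, h2]
  rw [mul_comm, Complex.re_add_im]

theorem ae_hasDerivWithinAt_primitive {g : ℝ → ℂ} {a b : ℝ} (hab : a ≤ b)
    (hg : IntervalIntegrable g volume a b) :
    ∀ᵐ x ∂volume.restrict (Icc a b),
      HasDerivWithinAt (fun x => ∫ t in a..x, g t) (g x) (Icc a b) x := by
  rw [ae_restrict_iff' measurableSet_Icc, ← uIcc_of_le hab]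
  filter_upwards [hg.ae_hasDerivAt_integral] with x hx hxm
  exact (hx hxm a left_mem_uIcc).hasDerivWithinAt

/-- The difference of `u` and the primitive of `g` is absolutely continuous with derivative zero
a.e., hence constant. -/
theorem AbsolutelyContinuousOnInterval.eq_add_integral {u g : ℝ → ℂ} {a b : ℝ} (hab : a ≤ b)
    (hu : AbsolutelyContinuousOnInterval u a b) (hg : IntervalIntegrable g volume a b)
    (hd : ∀ᵐ x ∂volume.restrict (Icc a b), HasDerivWithinAt u (g x) (Icc a b) x) {x : ℝ}
    (hx : x ∈ Icc a b) : u x = u a + ∫ t in a..x, g t := by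
  have hac := hu.sub (absolutelyContinuousOnInterval_primitive hg)
  have h0 : ∀ᵐ x, x ∈ uIcc a b → HasDerivAt (u - fun x => ∫ t in a..x, g t) 0 x := by
    have h1 := (ae_restrict_iff' measurableSet_Icc).1
      (hd.and (ae_hasDerivWithinAt_primitive hab hg))
    -- Off the endpoints, a null set, a derivative within `Icc a b` is a two-sided derivative.
    have ha : ∀ᵐ x : ℝ, x ≠ a := by simp [ae_iff]
    have hb : ∀ᵐ x : ℝ, x ≠ b := by simp [ae_iff]
    filter_upwards [h1, ha, hb] with x hx hxa hxb hxm
    rw [uIcc_of_le hab] at hxm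
    have hn : Icc a b ∈ nhds x :=
      Icc_mem_nhds (lt_of_le_of_ne hxm.1 hxa.symm) (lt_of_le_of_ne hxm.2 hxb)
    have h2 := ((hx hxm).1.hasDerivAt hn).sub ((hx hxm).2.hasDerivAt hn)
    rwa [sub_self] at h2
  obtain ⟨C, hC⟩ := hac.const_of_ae_hasDerivAt_zero h0
  have e1 := hC x (by rwa [uIcc_of_le hab])
  have e2 := hC a left_mem_uIcc
  simp only [Pi.sub_apply, intervalIntegral.integral_same, sub_zero] at e1 e2
  rw [e2, ← e1]
  ring

/-- Integration by parts for complex valued absolutely continuous functions. -/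
theorem AbsolutelyContinuousOnInterval.integral_mul_add_mul {u v u' v' : ℝ → ℂ} {a b : ℝ}
    (hab : a ≤ b) (hu : AbsolutelyContinuousOnInterval u a b)
    (hv : AbsolutelyContinuousOnInterval v a b)
    (hu' : IntervalIntegrable u' volume a b) (hv' : IntervalIntegrable v' volume a b)
    (hdu : ∀ᵐ x ∂volume.restrict (Icc a b), HasDerivWithinAt u (u' x) (Icc a b) x)
    (hdv : ∀ᵐ x ∂volume.restrict (Icc a b), HasDerivWithinAt v (v' x) (Icc a b) x) :
    (∫ t in a..b, u' t * v t) + ∫ t in a..b, u t * v' t = u b * v b - u a * v a := by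
  have h1 : IntervalIntegrable (fun t => u' t * v t) volume a b :=
    hu'.mul_continuousOn hv.continuousOn
  have h2 : IntervalIntegrable (fun t => u t * v' t) volume a b :=
    hv'.continuousOn_mul hu.continuousOn
  have h := (hu.smul hv).eq_add_integral hab (h1.add h2)
    (by filter_upwards [hdu, hdv] with x h1 h2 using h1.mul h2) (right_mem_Icc.2 hab)
  rw [← intervalIntegral.integral_add h1 h2]
  simp only [Pi.smul_apply', smul_eq_mul] at h
  rw [h]
  ring

end AC

/-! ### Sobolev functions of order one as primitives, and the graphs of `-i d/dx`. -/

theorem intervalIntegrable_coeFn {ℓ : ℝ} (hℓ : 0 < ℓ) (g : L2I ℓ) :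
    IntervalIntegrable g volume 0 ℓ := by
  rw [intervalIntegrable_iff_integrableOn_Icc_of_le hℓ.le]
  exact (Lp.memLp g).integrable one_le_two

theorem isSobolev_one_iff {ℓ : ℝ} (hℓ : 0 < ℓ) {u : ℝ → ℂ} {g : L2I ℓ} :
    IsSobolev ℓ 1 u g ↔ ∀ x ∈ Icc 0 ℓ, u x = u 0 + ∫ t in (0 : ℝ)..x, g t := by
  have hg := intervalIntegrable_coeFn hℓ g
  constructor
  · rintro ⟨-, h2, h3⟩ x hx
    rw [iteratedDerivWithin_zero] at h2 h3
    exact h2.eq_add_integral hℓ.le hg h3 hx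
  · intro h
    have hc : AbsolutelyContinuousOnInterval (fun _ : ℝ => u 0) 0 ℓ := by
      simp [AbsolutelyContinuousOnInterval, tendsto_const_nhds]
    have hac : AbsolutelyContinuousOnInterval u 0 ℓ :=
      ac_congr (fun x hx => (h x (by rwa [uIcc_of_le hℓ.le] at hx)).symm)
        (hc.add (absolutelyContinuousOnInterval_primitive hg))
    refine ⟨?_, by rwa [iteratedDerivWithin_zero], ?_⟩
    · rw [Nat.cast_zero, contDiffOn_zero, ← uIcc_of_le hℓ.le]
      exact hac.continuousOn
    · rw [iteratedDerivWithin_zero]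
      filter_upwards [ae_hasDerivWithinAt_primitive hℓ.le hg, ae_restrict_mem measurableSet_Icc]
        with x hx hxm
      exact (hx.const_add (u 0)).congr h (h x hxm)

theorem mem_graph_momentumOp_iff {ℓ : ℝ} (hℓ : 0 < ℓ) {n r : ℕ} (hr : r ≤ n) {φ η : L2I ℓ} :
    (φ, η) ∈ (momentumOp hℓ hr).graph ↔ ∃ (u : ℝ → ℂ) (g : L2I ℓ), IsSobolev ℓ n u g ∧
      φ =ᵐ[volume.restrict (Icc 0 ℓ)] u ∧
      (∀ k < r, iteratedDerivWithin k u (Icc 0 ℓ) 0 = 0 ∧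
        iteratedDerivWithin k u (Icc 0 ℓ) ℓ = 0) ∧ η = (-Complex.I) ^ n • g := by
  rw [momentumOp, diffOp_graph]
  rfl

theorem intervalIntegral_congr_of_ae_Icc {ℓ : ℝ} {f g : ℝ → ℂ}
    (h : f =ᵐ[volume.restrict (Icc 0 ℓ)] g) {x : ℝ} (hx : x ∈ Icc 0 ℓ) :
    ∫ t in (0 : ℝ)..x, f t = ∫ t in (0 : ℝ)..x, g t := by
  refine intervalIntegral.integral_congr_ae ?_
  filter_upwards [(ae_restrict_iff' measurableSet_Icc).1 h] with t ht htx
  rw [uIoc_of_le hx.1] at htx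
  exact ht ⟨htx.1.le, htx.2.trans hx.2⟩

theorem I_smul_coeFn {ℓ : ℝ} (η : L2I ℓ) :
    (Complex.I • η : L2I ℓ) =ᵐ[volume.restrict (Icc 0 ℓ)] fun t => Complex.I * η t :=
  Lp.coeFn_smul Complex.I η

theorem neg_I_smul_I_smul {ℓ : ℝ} (η : L2I ℓ) : -Complex.I • Complex.I • η = η := by
  rw [smul_smul]
  simp

theorem I_smul_neg_I_smul {ℓ : ℝ} (η : L2I ℓ) : Complex.I • -Complex.I • η = η := by
  rw [smul_smul]
  simp

/-- The graph of `-i d/dx` without boundary conditions. -/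
theorem mem_graph_momentumOp_one_zero_iff {ℓ : ℝ} (hℓ : 0 < ℓ) {φ η : L2I ℓ} :
    (φ, η) ∈ (momentumOp hℓ (Nat.zero_le 1)).graph ↔
      ∃ C : ℂ, φ =ᵐ[volume.restrict (Icc 0 ℓ)]
        fun x => C + ∫ t in (0 : ℝ)..x, Complex.I * η t := by
  rw [mem_graph_momentumOp_iff]
  constructor
  · rintro ⟨u, g, hu, hφ, -, rfl⟩
    refine ⟨u 0, ?_⟩
    filter_upwards [hφ, ae_restrict_mem measurableSet_Icc] with x hx hxm
    rw [hx, (isSobolev_one_iff hℓ).1 hu x hxm,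
      ← intervalIntegral_congr_of_ae_Icc (I_smul_coeFn _) hxm, pow_one, I_smul_neg_I_smul]
  · rintro ⟨C, hφ⟩
    refine ⟨_, Complex.I • η, (isSobolev_one_iff hℓ).2 fun x hx => ?_, hφ, by simp, ?_⟩
    · rw [intervalIntegral_congr_of_ae_Icc (I_smul_coeFn _) hx]
      simp
    · rw [pow_one, neg_I_smul_I_smul]

/-- The condition at `0` kills the constant of integration, and the condition at `ℓ` becomes the
vanishing mean of `η`. In this form neither condition refers to a chosen representative. -/
theorem mem_graph_minimalMomentum_iff {ℓ : ℝ} (hℓ : 0 < ℓ) {φ η : L2I ℓ} :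
    (φ, η) ∈ (minimalMomentum hℓ).graph ↔
      φ =ᵐ[volume.restrict (Icc 0 ℓ)] (fun x => ∫ t in (0 : ℝ)..x, Complex.I * η t) ∧
      ∫ t in (0 : ℝ)..ℓ, η t = 0 := by
  rw [minimalMomentum, mem_graph_momentumOp_iff]
  constructor
  · rintro ⟨u, g, hu, hφ, hb, rfl⟩
    have hb0 := hb 0 one_pos
    simp only [iteratedDerivWithin_zero] at hb0
    have h := (isSobolev_one_iff hℓ).1 hu
    rw [hb0.1] at h
    simp only [zero_add] at h
    have hI : ∀ x ∈ Icc 0 ℓ,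
        ∫ t in (0 : ℝ)..x, Complex.I * ((-Complex.I) ^ 1 • g : L2I ℓ) t = u x := fun x hx => by
      rw [h x hx, ← intervalIntegral_congr_of_ae_Icc (I_smul_coeFn _) hx, pow_one,
        I_smul_neg_I_smul]
    refine ⟨?_, ?_⟩
    · filter_upwards [hφ, ae_restrict_mem measurableSet_Icc] with x hx hxm
      rw [hx, hI x hxm]
    · have h1 := hI ℓ (right_mem_Icc.2 hℓ.le)
      rw [hb0.2, intervalIntegral.integral_const_mul] at h1
      simpa using h1
  · rintro ⟨hφ, h0⟩
    refine ⟨_, Complex.I • η, (isSobolev_one_iff hℓ).2 fun x hx => ?_, hφ, ?_, ?_⟩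
    · rw [intervalIntegral_congr_of_ae_Icc (I_smul_coeFn _) hx]
      simp
    · intro k hk
      obtain rfl : k = 0 := by omega
      simp [intervalIntegral.integral_const_mul, h0]
    · rw [pow_one, neg_I_smul_I_smul]

/-! ### Iterated derivatives -/

theorem IsSobolev.continuousOn {ℓ : ℝ} {m : ℕ} {u : ℝ → ℂ} {g : L2I ℓ}
    (hu : IsSobolev ℓ (m + 1) u g) : ContinuousOn u (Icc 0 ℓ) :=
  hu.1.continuousOn

theorem ContinuousOn.memLp_restrict_Icc {u : ℝ → ℂ} {a b : ℝ} (hu : ContinuousOn u (Icc a b)) :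
    MemLp u 2 (volume.restrict (Icc a b)) := by
  obtain ⟨C, hC⟩ := isCompact_Icc.exists_bound_of_continuousOn hu
  refine MemLp.of_bound (hu.aestronglyMeasurable measurableSet_Icc) C ?_
  filter_upwards [ae_restrict_mem measurableSet_Icc] with x hx using hC x hx

/-- Since `u` is a primitive of `h`, it is also a primitive of the continuous representative `v`, so
the derivative exists at every point and not only a.e. This is how regularity is gained when
operators are composed. -/
theorem IsSobolev.hasDerivWithinAt {ℓ : ℝ} (hℓ : 0 < ℓ) {u v : ℝ → ℂ} {h : L2I ℓ}
    (hu : IsSobolev ℓ 1 u h) (hv : ContinuousOn v (Icc 0 ℓ))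
    (hh : h =ᵐ[volume.restrict (Icc 0 ℓ)] v) {x : ℝ} (hx : x ∈ Icc 0 ℓ) :
    HasDerivWithinAt u (v x) (Icc 0 ℓ) x := by
  have hu' : ∀ y ∈ Icc 0 ℓ, u y = u 0 + ∫ t in (0 : ℝ)..y, v t := fun y hy => by
    rw [(isSobolev_one_iff hℓ).1 hu y hy, intervalIntegral_congr_of_ae_Icc hh hy]
  -- The fundamental theorem for the filter `𝓝[Icc 0 ℓ] x` finds this membership by instance search.
  have : Fact (x ∈ Icc 0 ℓ) := ⟨hx⟩
  have hd : HasDerivWithinAt (fun y => ∫ t in (0 : ℝ)..y, v t) (v x) (Icc 0 ℓ) x :=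
    intervalIntegral.integral_hasDerivWithinAt_right
      ((hv.mono (by rw [uIcc_of_le hx.1]; exact Icc_subset_Icc_right hx.2)).intervalIntegrable)
      (hv.stronglyMeasurableAtFilter_nhdsWithin measurableSet_Icc x) (hv x hx)
  exact (hd.const_add (u 0)).congr hu' (hu' x hx)

theorem eqOn_iteratedDerivWithin_succ {ℓ : ℝ} (hℓ : 0 < ℓ) {u v : ℝ → ℂ}
    (h : ∀ x ∈ Icc 0 ℓ, HasDerivWithinAt u (v x) (Icc 0 ℓ) x) (k : ℕ) :
    EqOn (iteratedDerivWithin (k + 1) u (Icc 0 ℓ)) (iteratedDerivWithin k v (Icc 0 ℓ))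
      (Icc 0 ℓ) := fun x hx => by
  rw [iteratedDerivWithin_succ']
  exact iteratedDerivWithin_congr
    (fun y hy => (h y hy).derivWithin (uniqueDiffOn_Icc hℓ y hy)) hx

/-- The orders start at `m + 1` because order `0` is an a.e. condition without a continuous
representative. -/
theorem isSobolev_succ_iff {ℓ : ℝ} (hℓ : 0 < ℓ) {m : ℕ} {u v : ℝ → ℂ} {g : L2I ℓ}
    (h : ∀ x ∈ Icc 0 ℓ, HasDerivWithinAt u (v x) (Icc 0 ℓ) x) :
    IsSobolev ℓ (m + 2) u g ↔ IsSobolev ℓ (m + 1) v g := by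
  have he := eqOn_iteratedDerivWithin_succ hℓ h m
  have hd : EqOn (derivWithin u (Icc 0 ℓ)) v (Icc 0 ℓ) := fun y hy =>
    (h y hy).derivWithin (uniqueDiffOn_Icc hℓ y hy)
  refine and_congr ?_ (and_congr ⟨ac_congr (by rwa [uIcc_of_le hℓ.le]),
    ac_congr (by rw [uIcc_of_le hℓ.le]; exact he.symm)⟩ ?_)
  · rw [Nat.cast_add, Nat.cast_one, contDiffOn_succ_iff_derivWithin (uniqueDiffOn_Icc hℓ)]
    constructor
    · rintro ⟨-, -, h3⟩
      exact h3.congr fun y hy => (hd hy).symm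
    · intro h3
      exact ⟨fun y hy => (h y hy).differentiableWithinAt, by simp, h3.congr hd⟩
  · refine Filter.eventually_congr ?_
    filter_upwards [ae_restrict_mem measurableSet_Icc] with x hx
    exact ⟨fun h => h.congr (fun y hy => (he hy).symm) (he hx).symm,
      fun h => h.congr he (he hx)⟩

theorem mem_graph_momentumOp_zero_iff {ℓ : ℝ} (hℓ : 0 < ℓ) {r : ℕ} (hr : r ≤ 0) {φ η : L2I ℓ} :
    (φ, η) ∈ (momentumOp hℓ hr).graph ↔ φ = η := by
  rw [mem_graph_momentumOp_iff]
  constructor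
  · rintro ⟨u, g, hu, hφ, -, rfl⟩
    rw [pow_zero, one_smul]
    exact Lp.ext (hφ.trans hu.symm)
  · rintro rfl
    exact ⟨φ, φ, Filter.EventuallyEq.rfl, Filter.EventuallyEq.rfl, fun k hk => by omega, by simp⟩

/-- Splits off the innermost derivative. Of the `r` boundary conditions at each end, the one on `u`
itself (if `r > 0`) stays with the first factor, and those on `u', …, u^(r-1)` become `r - 1`
conditions on `u'`. Truncated subtraction covers `r = 0`. -/
theorem mem_graph_momentumOp_succ_iff {ℓ : ℝ} (hℓ : 0 < ℓ) {n r r₁ r₂ : ℕ} (hr : r ≤ n + 1)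
    (h₁ : r₁ ≤ 1) (h₂ : r₂ ≤ n) (e₁ : r₁ = min r 1) (e₂ : r₂ = r - 1) {φ η : L2I ℓ} :
    (φ, η) ∈ (momentumOp hℓ hr).graph ↔
      ∃ θ, (φ, θ) ∈ (momentumOp hℓ h₁).graph ∧ (θ, η) ∈ (momentumOp hℓ h₂).graph := by
  obtain _ | m := n
  · obtain rfl : r = r₁ := by omega
    simp only [mem_graph_momentumOp_zero_iff, exists_eq_right]
  constructor
  · rw [mem_graph_momentumOp_iff]
    rintro ⟨u, g, hu, hφ, hb, rfl⟩
    set v := derivWithin u (Icc 0 ℓ) with hv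
    have hd : ∀ x ∈ Icc 0 ℓ, HasDerivWithinAt u (v x) (Icc 0 ℓ) x := fun x hx =>
      ((hu.1.differentiableOn (by simp)) x hx).hasDerivWithinAt
    have hvS : IsSobolev ℓ (m + 1) v g := (isSobolev_succ_iff hℓ hd).1 hu
    have hvL := hvS.continuousOn.memLp_restrict_Icc
    refine ⟨-Complex.I • hvL.toLp v, ?_, ?_⟩
    · refine (mem_graph_momentumOp_iff hℓ h₁).2 ⟨u, hvL.toLp v, ?_, hφ, ?_, by simp⟩
      · refine ⟨?_, ?_, ?_⟩
        · rw [Nat.cast_zero, contDiffOn_zero]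
          exact hu.continuousOn
        · rw [iteratedDerivWithin_zero]
          have h1 : ContDiffOn ℝ 1 u (uIcc 0 ℓ) := by
            rw [uIcc_of_le hℓ.le]
            exact hu.1.of_le (by simp)
          exact h1.absolutelyContinuousOnInterval
        · rw [iteratedDerivWithin_zero]
          filter_upwards [hvL.coeFn_toLp, ae_restrict_mem measurableSet_Icc] with x hx hxm
          rw [hx]
          exact hd x hxm
      · exact fun k hk => hb k (by omega)
    · refine (mem_graph_momentumOp_iff hℓ h₂).2 ⟨-Complex.I • v, -Complex.I • g,
        hvS.smul _, (Lp.coeFn_smul _ _).trans (hvL.coeFn_toLp.const_smul _), ?_, ?_⟩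
      · intro k hk
        have he := eqOn_iteratedDerivWithin_succ hℓ hd k
        have hbk := hb (k + 1) (by omega)
        rw [he (left_mem_Icc.2 hℓ.le), he (right_mem_Icc.2 hℓ.le)] at hbk
        rw [iteratedDerivWithin_const_smul_field, iteratedDerivWithin_const_smul_field, hbk.1,
          hbk.2]
        simp
      · rw [smul_smul, pow_succ]
  · rintro ⟨θ, h1, h2⟩
    obtain ⟨u, h, hu, hφ, hub, rfl⟩ := (mem_graph_momentumOp_iff hℓ h₁).1 h1
    obtain ⟨w, g, hw, hθ, hwb, rfl⟩ := (mem_graph_momentumOp_iff hℓ h₂).1 h2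
    have hvS := hw.smul Complex.I
    -- The intermediate vector is `-i h`, with Sobolev representative `w`; thus `h` has the
    -- continuous representative `i w`, and `u` is differentiable everywhere.
    have hh : h =ᵐ[volume.restrict (Icc 0 ℓ)] Complex.I • w := by
      have h3 := (Lp.coeFn_smul Complex.I ((-Complex.I) ^ 1 • h)).trans (hθ.const_smul Complex.I)
      rwa [pow_one, I_smul_neg_I_smul] at h3
    have hd : ∀ x ∈ Icc 0 ℓ, HasDerivWithinAt u ((Complex.I • w) x) (Icc 0 ℓ) x := fun x hx =>
      hu.hasDerivWithinAt hℓ hvS.continuousOn hh hx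
    refine (mem_graph_momentumOp_iff hℓ hr).2
      ⟨u, Complex.I • g, (isSobolev_succ_iff hℓ hd).2 hvS, hφ, ?_, ?_⟩
    · intro k hk
      obtain _ | k := k
      · exact hub 0 (by omega)
      have he := eqOn_iteratedDerivWithin_succ hℓ hd k
      have hbk := hwb k (by omega)
      rw [he (left_mem_Icc.2 hℓ.le), he (right_mem_Icc.2 hℓ.le),
        iteratedDerivWithin_const_smul_field, iteratedDerivWithin_const_smul_field, hbk.1, hbk.2]
      simp
    · rw [smul_smul, pow_succ _ (m + 1), mul_assoc]
      simp

theorem opPow_minimalMomentum {ℓ : ℝ} (hℓ : 0 < ℓ) (n : ℕ) :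
    opPow (minimalMomentum hℓ) n = momentumOp hℓ (le_refl n) := by
  refine LinearPMap.eq_of_eq_graph ?_
  ext ⟨φ, η⟩
  induction n generalizing φ with
  | zero => rw [mem_graph_opPow_zero_iff, mem_graph_momentumOp_zero_iff]
  | succ n ih =>
    rw [mem_graph_opPow_succ_iff', mem_graph_momentumOp_succ_iff hℓ (le_refl (n + 1))
      (le_refl 1) (le_refl n) (by omega) (by omega)]
    simp only [ih]
    rfl

/-- All `n` boundary conditions are used up by the inner, minimal factor, and the outer factor is
maximal. The case `m = n` yields the domain of `(P₀^n)* P₀^n`. -/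
theorem mem_graph_momentumOp_add_iff {ℓ : ℝ} (hℓ : 0 < ℓ) {m n k : ℕ} (hk : k = m + n)
    (h : n ≤ k) {φ η : L2I ℓ} :
    (φ, η) ∈ (momentumOp hℓ h).graph ↔ ∃ θ, (φ, θ) ∈ (momentumOp hℓ (le_refl n)).graph ∧
      (θ, η) ∈ (momentumOp hℓ (Nat.zero_le m)).graph := by
  subst hk
  induction n generalizing φ with
  | zero => simp only [mem_graph_momentumOp_zero_iff, exists_eq_left', Nat.add_zero]
  | succ n ih =>
    have h1 := fun φ => mem_graph_momentumOp_succ_iff hℓ (n := m + n) h (le_refl 1)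
      (Nat.le_add_left n m) (by omega) (by omega) (φ := φ) (η := η)
    rw [h1]
    simp only [ih, mem_graph_momentumOp_succ_iff hℓ (le_refl (n + 1))
      (le_refl 1) (le_refl n) (by omega) (by omega)]
    constructor
    · rintro ⟨θ, h2, ξ, h3, h4⟩
      exact ⟨ξ, ⟨θ, h2, h3⟩, h4⟩
    · rintro ⟨ξ, ⟨θ, h2, h3⟩, h4⟩
      exact ⟨θ, h2, ξ, h3, h4⟩

/-! ### Adjoints -/

theorem inner_L2I_eq {ℓ : ℝ} (hℓ : 0 < ℓ) (ψ φ : L2I ℓ) :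
    ⟪ψ, φ⟫_ℂ = ∫ t in (0 : ℝ)..ℓ, starRingEnd ℂ (ψ t) * φ t := by
  rw [L2.inner_def, intervalIntegral.integral_of_le hℓ.le, ← integral_Icc_eq_integral_Ioc]
  simp only [RCLike.inner_apply']

theorem intervalIntegrable_I_mul {ℓ : ℝ} (hℓ : 0 < ℓ) (η : L2I ℓ) :
    IntervalIntegrable (fun t => Complex.I * η t) volume 0 ℓ :=
  (intervalIntegrable_coeFn hℓ η).const_mul _

theorem absolutelyContinuousOnInterval_add_primitive {ℓ : ℝ} (hℓ : 0 < ℓ) (C : ℂ) (η : L2I ℓ) :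
    AbsolutelyContinuousOnInterval (fun x => C + ∫ t in (0 : ℝ)..x, Complex.I * η t) 0 ℓ := by
  have hc : AbsolutelyContinuousOnInterval (fun _ : ℝ => C) 0 ℓ := by
    simp [AbsolutelyContinuousOnInterval, tendsto_const_nhds]
  exact hc.add (absolutelyContinuousOnInterval_primitive (intervalIntegrable_I_mul hℓ η))

theorem ae_hasDerivWithinAt_add_primitive {ℓ : ℝ} (hℓ : 0 < ℓ) (C : ℂ) (η : L2I ℓ) :
    ∀ᵐ x ∂volume.restrict (Icc 0 ℓ), HasDerivWithinAt
      (fun x => C + ∫ t in (0 : ℝ)..x, Complex.I * η t) (Complex.I * η x) (Icc 0 ℓ) x := by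
  filter_upwards [ae_hasDerivWithinAt_primitive hℓ.le (intervalIntegrable_I_mul hℓ η)]
    with x hx using hx.const_add C

/-- Partial integration: `ψ` vanishes at both ends, so no boundary condition on `φ` is needed. -/
theorem inner_eq_inner_of_mem_graph {ℓ : ℝ} (hℓ : 0 < ℓ) {ψ ζ φ η : L2I ℓ}
    (h₁ : (ψ, ζ) ∈ (minimalMomentum hℓ).graph)
    (h₂ : (φ, η) ∈ (momentumOp hℓ (Nat.zero_le 1)).graph) : ⟪ζ, φ⟫_ℂ = ⟪ψ, η⟫_ℂ := by
  obtain ⟨hψ, h0⟩ := (mem_graph_minimalMomentum_iff hℓ).1 h₁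
  obtain ⟨C, hφ⟩ := (mem_graph_momentumOp_one_zero_iff hℓ).1 h₂
  have hζ := intervalIntegrable_I_mul hℓ ζ
  have hconj : IntervalIntegrable (fun t => starRingEnd ℂ (Complex.I * ζ t)) volume 0 ℓ := by
    rw [intervalIntegrable_iff] at hζ ⊢
    exact (LinearIsometryEquiv.integrable_comp_iff Complex.conjLIE).2 hζ
  have key := AbsolutelyContinuousOnInterval.integral_mul_add_mul hℓ.le
    (absolutelyContinuousOnInterval_primitive hζ).conj
    (absolutelyContinuousOnInterval_add_primitive hℓ C η) hconj (intervalIntegrable_I_mul hℓ η)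
    (by filter_upwards [ae_hasDerivWithinAt_primitive hℓ.le hζ] with x hx using hx.star)
    (ae_hasDerivWithinAt_add_primitive hℓ C η)
  simp only [intervalIntegral.integral_same, intervalIntegral.integral_const_mul Complex.I,
    h0, mul_zero, map_zero, zero_mul, sub_self] at key
  have e1 : ∫ t in (0 : ℝ)..ℓ, starRingEnd ℂ (Complex.I * ζ t) *
      (C + ∫ s in (0 : ℝ)..t, Complex.I * η s) = -Complex.I * ⟪ζ, φ⟫_ℂ := by
    rw [inner_L2I_eq hℓ, ← intervalIntegral.integral_const_mul]
    refine intervalIntegral_congr_of_ae_Icc ?_ (right_mem_Icc.2 hℓ.le)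
    filter_upwards [hφ] with t ht
    rw [ht, map_mul, Complex.conj_I, mul_assoc]
  have e2 : ∫ t in (0 : ℝ)..ℓ, starRingEnd ℂ (∫ s in (0 : ℝ)..t, Complex.I * ζ s) *
      (Complex.I * η t) = Complex.I * ⟪ψ, η⟫_ℂ := by
    rw [inner_L2I_eq hℓ, ← intervalIntegral.integral_const_mul]
    refine intervalIntegral_congr_of_ae_Icc ?_ (right_mem_Icc.2 hℓ.le)
    filter_upwards [hψ] with t ht
    rw [ht]
    ring
  simp only [← intervalIntegral.integral_const_mul Complex.I] at key
  rw [e1, e2] at key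
  have h3 : Complex.I * (⟪ψ, η⟫_ℂ - ⟪ζ, φ⟫_ℂ) = 0 := by linear_combination key
  rcases mul_eq_zero.1 h3 with h | h
  · exact absurd h Complex.I_ne_zero
  · exact (sub_eq_zero.1 h).symm

/-! ### Primitives, polynomials, and the adjoint of `P₀^n`. -/

theorem memLp_primitive {ℓ : ℝ} (hℓ : 0 < ℓ) (η : L2I ℓ) :
    MemLp (fun x => ∫ t in (0 : ℝ)..x, Complex.I * η t) 2 (volume.restrict (Icc 0 ℓ)) :=
  ((absolutelyContinuousOnInterval_primitive (intervalIntegrable_I_mul hℓ η)).continuousOn.mono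
    (uIcc_of_le hℓ.le).ge).memLp_restrict_Icc

/-- The Volterra operator `η ↦ i ∫₀ˣ η`. -/
noncomputable def volterra {ℓ : ℝ} (hℓ : 0 < ℓ) : L2I ℓ →ₗ[ℂ] L2I ℓ where
  toFun η := (memLp_primitive hℓ η).toLp _
  map_add' η η' := by
    rw [← MemLp.toLp_add, MemLp.toLp_eq_toLp_iff]
    filter_upwards [ae_restrict_mem measurableSet_Icc] with x hx
    have hsub : uIcc 0 x ⊆ uIcc 0 ℓ := by
      rw [uIcc_of_le hx.1, uIcc_of_le hℓ.le]
      exact Icc_subset_Icc_right hx.2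
    rw [Pi.add_apply, ← intervalIntegral.integral_add
      ((intervalIntegrable_I_mul hℓ η).mono_set hsub)
      ((intervalIntegrable_I_mul hℓ η').mono_set hsub)]
    refine intervalIntegral_congr_of_ae_Icc ?_ hx
    filter_upwards [Lp.coeFn_add η η'] with t ht
    rw [ht, Pi.add_apply, mul_add]
  map_smul' c η := by
    rw [RingHom.id_apply, ← MemLp.toLp_const_smul, MemLp.toLp_eq_toLp_iff]
    filter_upwards [ae_restrict_mem measurableSet_Icc] with x hx
    rw [Pi.smul_apply, smul_eq_mul, ← intervalIntegral.integral_const_mul]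
    refine intervalIntegral_congr_of_ae_Icc ?_ hx
    filter_upwards [Lp.coeFn_smul c η] with t ht
    rw [ht, Pi.smul_apply, smul_eq_mul]
    ring

theorem volterra_coeFn {ℓ : ℝ} (hℓ : 0 < ℓ) (η : L2I ℓ) :
    volterra hℓ η =ᵐ[volume.restrict (Icc 0 ℓ)] fun x => ∫ t in (0 : ℝ)..x, Complex.I * η t :=
  (memLp_primitive hℓ η).coeFn_toLp

theorem volterra_mem_graph {ℓ : ℝ} (hℓ : 0 < ℓ) (η : L2I ℓ) :
    (volterra hℓ η, η) ∈ (momentumOp hℓ (Nat.zero_le 1)).graph :=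
  (mem_graph_momentumOp_one_zero_iff hℓ).2 ⟨0, by simpa using volterra_coeFn hℓ η⟩

/-- The constant function `1` on `[0, ℓ]`. -/
noncomputable def constOne (ℓ : ℝ) : L2I ℓ := (memLp_const (1 : ℂ)).toLp _

theorem constOne_coeFn (ℓ : ℝ) : constOne ℓ =ᵐ[volume.restrict (Icc 0 ℓ)] fun _ => (1 : ℂ) :=
  MemLp.coeFn_toLp _

theorem constOne_mem_graph {ℓ : ℝ} (hℓ : 0 < ℓ) :
    (constOne ℓ, 0) ∈ (momentumOp hℓ (Nat.zero_le 1)).graph := by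
  refine (mem_graph_momentumOp_one_zero_iff hℓ).2 ⟨1, ?_⟩
  filter_upwards [constOne_coeFn ℓ, ae_restrict_mem measurableSet_Icc] with x hx hxm
  have h0 : (fun t => Complex.I * (0 : L2I ℓ) t) =ᵐ[volume.restrict (Icc 0 ℓ)] fun _ => 0 := by
    filter_upwards [Lp.coeFn_zero ℂ 2 (volume.restrict (Icc 0 ℓ))] with t ht
    rw [ht, Pi.zero_apply, mul_zero]
  rw [hx, intervalIntegral_congr_of_ae_Icc h0 hxm]
  simp

/-- The polynomials of degree less than `n`, i.e. the kernel of the maximal operator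
`(-i d/dx)^n`. -/
noncomputable def polySpace {ℓ : ℝ} (hℓ : 0 < ℓ) : ℕ → Submodule ℂ (L2I ℓ)
  | 0 => ⊥
  | n + 1 => (polySpace hℓ n).map (volterra hℓ) ⊔ ℂ ∙ constOne ℓ

instance finiteDimensional_polySpace {ℓ : ℝ} (hℓ : 0 < ℓ) (n : ℕ) :
    FiniteDimensional ℂ (polySpace hℓ n) := by
  induction n with
  | zero => exact inferInstanceAs (FiniteDimensional ℂ (⊥ : Submodule ℂ (L2I ℓ)))
  | succ n ih =>
    exact inferInstanceAs (FiniteDimensional ℂ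
      ((polySpace hℓ n).map (volterra hℓ) ⊔ ℂ ∙ constOne ℓ : Submodule ℂ (L2I ℓ)))

theorem polySpace_mem_graph {ℓ : ℝ} (hℓ : 0 < ℓ) {n : ℕ} {κ : L2I ℓ} (hκ : κ ∈ polySpace hℓ n) :
    (κ, 0) ∈ (momentumOp hℓ (Nat.zero_le n)).graph := by
  induction n generalizing κ with
  | zero => exact (mem_graph_momentumOp_zero_iff hℓ _).2 ((Submodule.mem_bot ℂ).1 hκ)
  | succ n ih =>
    obtain ⟨_, ⟨κ', hκ', rfl⟩, _, hc, rfl⟩ := Submodule.mem_sup.1 hκ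
    obtain ⟨c, rfl⟩ := Submodule.mem_span_singleton.1 hc
    refine (mem_graph_momentumOp_succ_iff hℓ (Nat.zero_le (n + 1)) (Nat.zero_le 1)
      (Nat.zero_le n) (by omega) (by omega)).2 ⟨κ', ?_, ih hκ'⟩
    have := add_mem (volterra_mem_graph hℓ κ') (Submodule.smul_mem _ c (constOne_mem_graph hℓ))
    simpa using this

/-- Orthogonality to `1` makes the primitive of `ξ` vanish at `ℓ`, so it lies in `dom P₀`.
Orthogonality to the primitives of lower polynomials `κ` moves, by partial integration, to
orthogonality of the primitive of `ξ` to `κ`, and the induction continues. -/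
theorem exists_mem_graph_opPow_of_orthogonal {ℓ : ℝ} (hℓ : 0 < ℓ) {n : ℕ} {ξ : L2I ℓ}
    (hξ : ∀ κ ∈ polySpace hℓ n, ⟪κ, ξ⟫_ℂ = 0) : ∃ ω, (ω, ξ) ∈ (opPow (minimalMomentum hℓ) n).graph := by
  induction n generalizing ξ with
  | zero => exact ⟨ξ, (mem_graph_opPow_zero_iff _).2 rfl⟩
  | succ n ih =>
    have h0 : ∫ t in (0 : ℝ)..ℓ, ξ t = 0 := by
      rw [← hξ (constOne ℓ) (Submodule.mem_sup_right (Submodule.mem_span_singleton_self _)),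
        inner_L2I_eq hℓ]
      refine intervalIntegral_congr_of_ae_Icc ?_ (right_mem_Icc.2 hℓ.le)
      filter_upwards [constOne_coeFn ℓ] with t ht
      simp [ht]
    have hζ : (volterra hℓ ξ, ξ) ∈ (minimalMomentum hℓ).graph :=
      (mem_graph_minimalMomentum_iff hℓ).2 ⟨volterra_coeFn hℓ ξ, h0⟩
    obtain ⟨ω, hω⟩ := ih (ξ := volterra hℓ ξ) fun κ hκ => by
      rw [← inner_conj_symm, ← inner_eq_inner_of_mem_graph hℓ hζ (volterra_mem_graph hℓ κ),
        inner_conj_symm]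
      exact hξ _ (Submodule.mem_sup_left (Submodule.mem_map_of_mem hκ))
    exact ⟨ω, (mem_graph_opPow_succ_iff _).2 ⟨_, hω, hζ⟩⟩

/-- A finite dimensional space equals its double orthogonal complement, and the range of `P₀^n`
contains the single complement. -/
theorem mem_polySpace_of_orthogonal {ℓ : ℝ} (hℓ : 0 < ℓ) {n : ℕ} {θ : L2I ℓ}
    (hθ : ∀ ω ξ, (ω, ξ) ∈ (opPow (minimalMomentum hℓ) n).graph → ⟪ξ, θ⟫_ℂ = 0) :
    θ ∈ polySpace hℓ n := by
  rw [← Submodule.orthogonal_orthogonal (polySpace hℓ n), Submodule.mem_orthogonal]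
  intro ξ hξ
  obtain ⟨ω, hω⟩ := exists_mem_graph_opPow_of_orthogonal hℓ ((Submodule.mem_orthogonal _ _).1 hξ)
  exact hθ ω ξ hω

theorem inner_opPow_eq_inner {ℓ : ℝ} (hℓ : 0 < ℓ) {n : ℕ} {ψ ζ φ η : L2I ℓ}
    (h₁ : (ψ, ζ) ∈ (opPow (minimalMomentum hℓ) n).graph)
    (h₂ : (φ, η) ∈ (momentumOp hℓ (Nat.zero_le n)).graph) : ⟪ζ, φ⟫_ℂ = ⟪ψ, η⟫_ℂ := by
  induction n generalizing ζ φ with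
  | zero =>
    rw [(mem_graph_opPow_zero_iff _).1 h₁, (mem_graph_momentumOp_zero_iff hℓ _).1 h₂]
  | succ n ih =>
    obtain ⟨ξ, h3, h4⟩ := (mem_graph_opPow_succ_iff _).1 h₁
    obtain ⟨θ, h5, h6⟩ := (mem_graph_momentumOp_succ_iff hℓ (Nat.zero_le (n + 1))
      (Nat.zero_le 1) (Nat.zero_le n) (by omega) (by omega)).1 h₂
    rw [inner_eq_inner_of_mem_graph hℓ h4 h5, ih h3 h6]

theorem exists_mem_graph_momentumOp_zero {ℓ : ℝ} (hℓ : 0 < ℓ) (n : ℕ) (η : L2I ℓ) :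
    ∃ κ, (κ, η) ∈ (momentumOp hℓ (Nat.zero_le n)).graph := by
  induction n with
  | zero => exact ⟨η, (mem_graph_momentumOp_zero_iff hℓ _).2 rfl⟩
  | succ n ih =>
    obtain ⟨κ, hκ⟩ := ih
    exact ⟨volterra hℓ κ, (mem_graph_momentumOp_succ_iff hℓ (Nat.zero_le (n + 1))
      (Nat.zero_le 1) (Nat.zero_le n) (by omega) (by omega)).2
        ⟨κ, volterra_mem_graph hℓ κ, hκ⟩⟩

/-- If `θ` is orthogonal to the domain, let `κ` be an `n`-fold primitive of it. Then `⟪P₀^n ω, κ⟫ =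
⟪ω, θ⟫ = 0`, so `κ` is a polynomial of degree `< n` and `θ`, its `n`-th derivative up to a factor,
is zero. -/
theorem dense_opPow_minimalMomentum {ℓ : ℝ} (hℓ : 0 < ℓ) (n : ℕ) :
    Dense ((opPow (minimalMomentum hℓ) n).domain : Set (L2I ℓ)) := by
  rw [Submodule.dense_iff_topologicalClosure_eq_top, Submodule.topologicalClosure_eq_top_iff,
    Submodule.eq_bot_iff]
  intro θ hθ
  rw [Submodule.mem_orthogonal] at hθ
  obtain ⟨κ, hκ⟩ := exists_mem_graph_momentumOp_zero hℓ n θ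
  have h1 : κ ∈ polySpace hℓ n := mem_polySpace_of_orthogonal hℓ fun ω ξ hω => by
    rw [inner_opPow_eq_inner hℓ hω hκ]
    exact hθ ω (LinearPMap.mem_domain_of_mem_graph hω)
  exact (LinearPMap.mem_graph_snd_inj _ hκ (polySpace_mem_graph hℓ h1) rfl)

/-- If `(φ, η)` satisfies the adjoint relation, `φ` differs from an `n`-fold primitive `κ` of `η` by
a vector orthogonal to the range of `P₀^n`, that is, by a polynomial in the kernel of the maximal
operator. -/
theorem adjoint_opPow_minimalMomentum {ℓ : ℝ} (hℓ : 0 < ℓ) (n : ℕ) :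
    (opPow (minimalMomentum hℓ) n).adjoint = momentumOp hℓ (Nat.zero_le n) := by
  refine LinearPMap.eq_of_eq_graph ?_
  rw [LinearPMap.adjoint_graph_eq_graph_adjoint (dense_opPow_minimalMomentum hℓ n)]
  ext ⟨φ, η⟩
  rw [Submodule.mem_adjoint_iff]
  constructor
  · intro h
    obtain ⟨κ, hκ⟩ := exists_mem_graph_momentumOp_zero hℓ n η
    have h1 : φ - κ ∈ polySpace hℓ n := mem_polySpace_of_orthogonal hℓ fun ω ξ hω => by
      rw [inner_sub_right, inner_opPow_eq_inner hℓ hω hκ]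
      exact h ω ξ hω
    simpa using add_mem (polySpace_mem_graph hℓ h1) hκ
  · intro h ω ξ hω
    exact sub_eq_zero.2 (inner_opPow_eq_inner hℓ hω h)

/-! ### The Fourier transform of integrable square integrable functions -/

section Fourier

open FourierTransform
open scoped ContDiff

theorem continuous_fourier_of_integrable {f : ℝ → ℂ} (hf : Integrable f) :
    Continuous (𝓕 f : ℝ → ℂ) :=
  VectorFourier.fourierIntegral_continuous Real.continuous_fourierChar
    (by exact continuous_inner) hf

theorem continuous_fourierInv_of_integrable {f : ℝ → ℂ} (hf : Integrable f) :
    Continuous (𝓕⁻ f : ℝ → ℂ) := by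
  have h : (𝓕⁻ f : ℝ → ℂ) = fun x => 𝓕 f (-x) := by
    ext x
    rw [Real.fourierInv_eq_fourier_neg]
  rw [h]
  exact (continuous_fourier_of_integrable hf).comp continuous_neg

theorem integral_fourier_mul_eq {f g : ℝ → ℂ} (hf : Integrable f) (hg : Integrable g) :
    ∫ x, 𝓕 g x * f x = ∫ x, g x * 𝓕 f x := by
  have h := VectorFourier.integral_fourierIntegral_smul_eq_flip (L := innerₗ ℝ)
    Real.continuous_fourierChar (by exact continuous_inner) hg hf
  rw [flip_innerₗ] at h
  exact h

theorem integral_fourierInv_mul_eq {f g : ℝ → ℂ} (hf : Integrable f) (hg : Integrable g) :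
    ∫ x, 𝓕⁻ g x * f x = ∫ x, g x * 𝓕⁻ f x := by
  have h := integral_fourier_mul_eq hf.comp_neg hg
  have e : ∀ x, (𝓕 (fun y => f (-y)) : ℝ → ℂ) x = 𝓕⁻ f x := fun x => by
    rw [Real.fourierInv_eq_fourier_comp_neg]
  simp only [e] at h
  rw [← h, ← integral_neg_eq_self]
  simp only [Real.fourierInv_eq_fourier_neg, neg_neg]

/-- Both sides have the same integral against every smooth compactly supported function: the left
one by its description as a tempered distribution, the right one by `integral_fourier_mul_eq`. -/
theorem Lp.fourier_ae_eq (f : L2R) (hf : Integrable f) :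
    (𝓕 f : L2R) =ᵐ[volume] (𝓕 (f : ℝ → ℂ) : ℝ → ℂ) := by
  refine ae_eq_of_integral_contDiff_smul_eq ((Lp.memLp _).locallyIntegrable one_le_two)
    (continuous_fourier_of_integrable hf).locallyIntegrable fun g hg hc => ?_
  have hg₁ : HasCompactSupport (Complex.ofRealCLM ∘ g) := hc.comp_left rfl
  have hg₂ : ContDiff ℝ ∞ (Complex.ofRealCLM ∘ g) := by fun_prop
  let G := hg₁.toSchwartzMap hg₂
  have h := DFunLike.congr_fun (Lp.fourier_toTemperedDistribution_eq f) G
  rw [TemperedDistribution.fourier_apply, Lp.toTemperedDistribution_apply,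
    Lp.toTemperedDistribution_apply, SchwartzMap.fourier_coe] at h
  simp only [smul_eq_mul] at h
  rw [integral_fourier_mul_eq hf G.integrable] at h
  exact h.symm

theorem Lp.fourierInv_ae_eq (f : L2R) (hf : Integrable f) :
    (𝓕⁻ f : L2R) =ᵐ[volume] (𝓕⁻ (f : ℝ → ℂ) : ℝ → ℂ) := by
  refine ae_eq_of_integral_contDiff_smul_eq ((Lp.memLp _).locallyIntegrable one_le_two)
    (continuous_fourierInv_of_integrable hf).locallyIntegrable fun g hg hc => ?_
  have hg₁ : HasCompactSupport (Complex.ofRealCLM ∘ g) := hc.comp_left rfl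
  have hg₂ : ContDiff ℝ ∞ (Complex.ofRealCLM ∘ g) := by fun_prop
  let G := hg₁.toSchwartzMap hg₂
  have h := DFunLike.congr_fun (Lp.fourierInv_toTemperedDistribution_eq f) G
  rw [TemperedDistribution.fourierInv_apply, Lp.toTemperedDistribution_apply,
    Lp.toTemperedDistribution_apply, SchwartzMap.fourierInv_coe] at h
  simp only [smul_eq_mul] at h
  rw [integral_fourierInv_mul_eq hf G.integrable] at h
  exact h.symm

/-- The normalization constant `(2π)^{-1/2}` of the Fourier transform. -/
noncomputable def fourierConst : ℂ := (((Real.sqrt (2 * Real.pi))⁻¹ : ℝ) : ℂ)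

theorem fourierConst_ne_zero : fourierConst ≠ 0 := by
  rw [fourierConst, Complex.ofReal_ne_zero]
  positivity

theorem fourierConst_mul_self : fourierConst * fourierConst = ((2 * Real.pi)⁻¹ : ℝ) := by
  rw [fourierConst, ← Complex.ofReal_mul, ← mul_inv, Real.mul_self_sqrt (by positivity)]

theorem conj_fourierConst : starRingEnd ℂ fourierConst = fourierConst :=
  Complex.conj_ofReal _

theorem fourierPlancherel_apply (f : L2R) : fourierPlancherel f = dilation (𝓕 f) := rfl

theorem fourierPlancherel_ae_eq (f : L2R) (hf : Integrable f) :
    fourierPlancherel f =ᵐ[volume] fun x =>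
      fourierConst * ∫ t : ℝ, Complex.exp (-Complex.I * x * t) * f t := by
  rw [fourierPlancherel_apply]
  refine (dilation_coeFn _).trans ?_
  filter_upwards [quasi_dilation.ae (Lp.fourier_ae_eq f hf)] with x hx
  rw [hx, Real.fourier_eq', fourierConst]
  congr 1
  refine integral_congr_ae (Filter.Eventually.of_forall fun t => ?_)
  have hp : (Real.pi : ℂ) ≠ 0 := by exact_mod_cast Real.pi_ne_zero
  simp only [smul_eq_mul]
  congr 2
  simp
  field_simp

theorem ae_eq_fourierPlancherel_inv (f : L2R) (hf : Integrable (fourierPlancherel f)) :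
    f =ᵐ[volume] fun t =>
      fourierConst * ∫ x : ℝ, Complex.exp (Complex.I * x * t) * fourierPlancherel f x := by
  have hp : (0 : ℝ) < 2 * Real.pi := by positivity
  have hd := dilation_coeFn (𝓕 f)
  rw [← fourierPlancherel_apply] at hd
  change _ =ᵐ[_] fun x => fourierConst * _ at hd
  have hF : Integrable (𝓕 f : L2R) := by
    have h1 := (hf.congr hd).const_mul fourierConst⁻¹
    simp only [← mul_assoc, inv_mul_cancel₀ fourierConst_ne_zero, one_mul] at h1
    exact (integrable_comp_mul_right_iff _ (by positivity)).1 h1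
  have h2 := Lp.fourierInv_ae_eq (𝓕 f) hF
  rw [FourierPair.fourierInv_fourier_eq] at h2
  filter_upwards [h2] with t ht
  rw [ht, Real.fourierInv_eq']
  have e : ∫ x : ℝ, Complex.exp (Complex.I * x * t) * fourierPlancherel f x =
      fourierConst * ∫ x : ℝ, (fun v : ℝ => Complex.exp (((2 * Real.pi * ⟪v, t⟫_ℝ : ℝ) : ℂ) *
        Complex.I) • (𝓕 f : L2R) v) (x * (2 * Real.pi)⁻¹) := by
    rw [← integral_const_mul]
    refine integral_congr_ae ?_
    filter_upwards [hd] with x hx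
    have hp : (Real.pi : ℂ) ≠ 0 := by exact_mod_cast Real.pi_ne_zero
    have he : Complex.I * x * t =
        ((2 * Real.pi * ⟪x * (2 * Real.pi)⁻¹, t⟫_ℝ : ℝ) : ℂ) * Complex.I := by
      simp
      field_simp
    rw [hx, he, smul_eq_mul]
    ring
  -- The two normalization constants multiply to `(2π)⁻¹`, which cancels the Jacobian of `x = 2πv`.
  rw [e, Measure.integral_comp_mul_right (fun v : ℝ => Complex.exp
    (((2 * Real.pi * ⟪v, t⟫_ℝ : ℝ) : ℂ) * Complex.I) • (𝓕 f : L2R) v), ← mul_assoc, fourierConst_mul_self, inv_inv,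
    abs_of_pos hp, ← Complex.real_smul, smul_smul, inv_mul_cancel₀ hp.ne', one_smul]

theorem norm_fourierPlancherel (f : L2R) : ‖fourierPlancherel f‖ = ‖f‖ := by
  rw [fourierPlancherel_apply, dilation, LinearMap.mkContinuous_apply, LinearMap.coe_mk,
    AddHom.coe_mk, Lp.norm_toLp, eLpNorm_dilation, ← Lp.norm_def, Lp.norm_fourier_eq]

end Fourier

/-! ### The isometry `W = F U` and its integral formulas. -/

theorem extendZero_coeFn {ℓ : ℝ} (φ : L2I ℓ) :
    extendZero ℓ φ =ᵐ[volume] (Icc 0 ℓ).indicator φ :=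
  ((memLp_indicator_iff_restrict measurableSet_Icc).2 (Lp.memLp φ)).coeFn_toLp

theorem norm_extendZero {ℓ : ℝ} (φ : L2I ℓ) : ‖extendZero ℓ φ‖ = ‖φ‖ := by
  rw [extendZero, LinearMap.mkContinuous_apply, LinearMap.coe_mk, AddHom.coe_mk, Lp.norm_toLp,
    eLpNorm_indicator_eq_eLpNorm_restrict measurableSet_Icc, ← Lp.norm_def]

/-- The Fourier transform of the extension by zero. -/
noncomputable def boxFourier (ℓ : ℝ) : L2I ℓ →ₗᵢ[ℂ] L2R where
  toLinearMap := (fourierPlancherel ∘L extendZero ℓ : L2I ℓ →L[ℂ] L2R)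
  norm_map' φ := (norm_fourierPlancherel _).trans (norm_extendZero φ)

theorem inner_boxFourier {ℓ : ℝ} (ψ φ : L2I ℓ) :
    ∫ x, starRingEnd ℂ (boxFourier ℓ ψ x) * boxFourier ℓ φ x = ⟪ψ, φ⟫_ℂ := by
  rw [← (boxFourier ℓ).inner_map_map, L2.inner_def]
  simp only [RCLike.inner_apply']

theorem boxFourier_ae_eq {ℓ : ℝ} (hℓ : 0 < ℓ) (φ : L2I ℓ) :
    boxFourier ℓ φ =ᵐ[volume] fun x : ℝ =>
      fourierConst * ∫ t in (0 : ℝ)..ℓ, Complex.exp (-Complex.I * x * t) * φ t := by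
  have hi : Integrable (extendZero ℓ φ) := by
    rw [integrable_congr (extendZero_coeFn φ), integrable_indicator_iff measurableSet_Icc]
    exact (Lp.memLp φ).integrable one_le_two
  refine (fourierPlancherel_ae_eq _ hi).trans (Filter.Eventually.of_forall fun x => ?_)
  dsimp only
  congr 1
  rw [intervalIntegral.integral_of_le hℓ.le, ← integral_Icc_eq_integral_Ioc,
    ← integral_indicator measurableSet_Icc]
  refine integral_congr_ae ?_
  filter_upwards [extendZero_coeFn φ] with t ht
  rw [ht]
  by_cases h : t ∈ Icc 0 ℓ <;> simp [h]

theorem ae_eq_boxFourier_inv {ℓ : ℝ} {φ : L2I ℓ} (hφ : Integrable (boxFourier ℓ φ)) :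
    (Icc 0 ℓ).indicator φ =ᵐ[volume] fun t : ℝ =>
      fourierConst * ∫ x : ℝ, Complex.exp (Complex.I * x * t) * boxFourier ℓ φ x :=
  (extendZero_coeFn φ).symm.trans (ae_eq_fourierPlancherel_inv _ hφ)

/-! ### The truncated momentum observable as a family of complex measures with densities -/

theorem integrable_conj_mul_boxFourier {ℓ : ℝ} (ψ φ : L2I ℓ) :
    Integrable fun x => starRingEnd ℂ (boxFourier ℓ ψ x) * boxFourier ℓ φ x := by
  have h := L2.integrable_inner (𝕜 := ℂ) (boxFourier ℓ ψ) (boxFourier ℓ φ)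
  simpa only [RCLike.inner_apply'] using h

theorem complexMeasure_truncatedMomentum {ℓ : ℝ} (ψ φ : L2I ℓ) :
    (truncatedMomentum ℓ).complexMeasure ψ φ = volume.withDensityᵥ
      fun x => starRingEnd ℂ (boxFourier ℓ ψ x) * boxFourier ℓ φ x := by
  ext X hX
  rw [POVM.complexMeasure_apply _ _ _ hX,
    withDensityᵥ_apply (integrable_conj_mul_boxFourier ψ φ) hX]
  have h : ⟪ψ, (truncatedMomentum ℓ).op X φ⟫_ℂ =
      ⟪boxFourier ℓ ψ, positionR.op X (boxFourier ℓ φ)⟫_ℂ := by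
    change ⟪ψ, (extendZero ℓ).adjoint (fourierPlancherel.adjoint _)⟫_ℂ = _
    rw [ContinuousLinearMap.adjoint_inner_right, ContinuousLinearMap.adjoint_inner_right]
    rfl
  have h2 : positionR.op X = indicatorMul X hX := dif_pos hX
  rw [h, h2, inner_indicatorMul]
  simp only [RCLike.inner_apply']

theorem integrable_complexMeasure_iff {ℓ : ℝ} (ψ φ : L2I ℓ) (k : ℕ) :
    ((truncatedMomentum ℓ).complexMeasure ψ φ).Integrable (fun x : ℝ => (x : ℂ) ^ k) ↔
      Integrable fun x : ℝ =>
        (x : ℂ) ^ k * (starRingEnd ℂ (boxFourier ℓ ψ x) * boxFourier ℓ φ x) := by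
  rw [complexMeasure_truncatedMomentum]
  exact integrable_withDensityᵥ_iff (integrable_conj_mul_boxFourier ψ φ) (by fun_prop)

theorem formIntegral_truncatedMomentum {ℓ : ℝ} {ψ φ : L2I ℓ} {k : ℕ}
    (h : ((truncatedMomentum ℓ).complexMeasure ψ φ).Integrable (fun x : ℝ => (x : ℂ) ^ k)) :
    (truncatedMomentum ℓ).formIntegral (fun x : ℝ => (x : ℂ) ^ k) ψ φ =
      ∫ x : ℝ, (x : ℂ) ^ k * (starRingEnd ℂ (boxFourier ℓ ψ x) * boxFourier ℓ φ x) := by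
  rw [POVM.formIntegral]
  rw [complexMeasure_truncatedMomentum] at h ⊢
  exact integral_withDensityᵥ (integrable_conj_mul_boxFourier ψ φ) h

/-! ### The momentum operator on the Fourier side -/

theorem hasDerivAt_exp_neg_I_mul (x t : ℝ) :
    HasDerivAt (fun t : ℝ => Complex.exp (-Complex.I * x * t))
      (-Complex.I * x * Complex.exp (-Complex.I * x * t)) t := by
  have h : HasDerivAt (fun t : ℝ => -Complex.I * x * (t : ℂ)) (-Complex.I * x) t := by
    simpa using (Complex.ofRealCLM.hasDerivAt (x := t)).const_mul (-Complex.I * (x : ℂ))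
  simpa [mul_comm] using h.cexp

/-- Partial integration against `e^(-ixt)` with the boundary term kept: `C` is the value of `φ` at
`0`, and `C` plus the integral is its value at `ℓ`. The term vanishes on `dom P₀`; for the first
weak moment it is the obstruction. -/
theorem boxFourier_ae_eq_of_primitive {ℓ : ℝ} (hℓ : 0 < ℓ) {φ η : L2I ℓ} {C : ℂ}
    (hφ : φ =ᵐ[volume.restrict (Icc 0 ℓ)] fun x => C + ∫ t in (0 : ℝ)..x, Complex.I * η t) :
    boxFourier ℓ η =ᵐ[volume] fun x : ℝ => x * boxFourier ℓ φ x - Complex.I * fourierConst *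
      ((C + ∫ t in (0 : ℝ)..ℓ, Complex.I * η t) * Complex.exp (-Complex.I * x * ℓ) - C) := by
  filter_upwards [boxFourier_ae_eq hℓ φ, boxFourier_ae_eq hℓ η] with x h1 h2
  have hc : ContDiff ℝ 1 fun t : ℝ => Complex.exp (-Complex.I * x * t) :=
    (contDiff_const.mul Complex.ofRealCLM.contDiff).cexp
  have hc' : Continuous fun t : ℝ => -Complex.I * x * Complex.exp (-Complex.I * x * t) := by
    fun_prop
  have key := AbsolutelyContinuousOnInterval.integral_mul_add_mul hℓ.le
    (absolutelyContinuousOnInterval_add_primitive hℓ C η)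
    hc.contDiffOn.absolutelyContinuousOnInterval
    (intervalIntegrable_I_mul hℓ η) (hc'.intervalIntegrable 0 ℓ)
    (ae_hasDerivWithinAt_add_primitive hℓ C η)
    (Filter.Eventually.of_forall fun t => (hasDerivAt_exp_neg_I_mul x t).hasDerivWithinAt)
  have e1 : ∫ t in (0 : ℝ)..ℓ, Complex.I * η t * Complex.exp (-Complex.I * x * t) =
      Complex.I * ∫ t in (0 : ℝ)..ℓ, Complex.exp (-Complex.I * x * t) * η t := by
    rw [← intervalIntegral.integral_const_mul]
    congr 1 with t
    ring
  have e2 : ∫ t in (0 : ℝ)..ℓ, (C + ∫ s in (0 : ℝ)..t, Complex.I * η s) *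
      (-Complex.I * x * Complex.exp (-Complex.I * x * t)) =
      -Complex.I * x * ∫ t in (0 : ℝ)..ℓ, Complex.exp (-Complex.I * x * t) * φ t := by
    rw [← intervalIntegral.integral_const_mul]
    refine intervalIntegral_congr_of_ae_Icc ?_ (right_mem_Icc.2 hℓ.le)
    filter_upwards [hφ] with t ht
    rw [ht]
    ring
  rw [e1, e2] at key
  simp only [intervalIntegral.integral_same, add_zero, Complex.ofReal_zero, mul_zero,
    Complex.exp_zero, mul_one] at key
  rw [h1, h2, ← key]
  linear_combination (fourierConst * (∫ t in (0 : ℝ)..ℓ, Complex.exp (-Complex.I * x * t) * η t)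
    - fourierConst * x * ∫ t in (0 : ℝ)..ℓ, Complex.exp (-Complex.I * x * t) * φ t) *
    Complex.I_mul_I

theorem boxFourier_ae_eq_of_mem_graph {ℓ : ℝ} (hℓ : 0 < ℓ) {φ η : L2I ℓ}
    (h : (φ, η) ∈ (minimalMomentum hℓ).graph) :
    boxFourier ℓ η =ᵐ[volume] fun x : ℝ => x * boxFourier ℓ φ x := by
  obtain ⟨hφ, h0⟩ := (mem_graph_minimalMomentum_iff hℓ).1 h
  filter_upwards [boxFourier_ae_eq_of_primitive (C := 0) hℓ (by simpa using hφ)] with x hx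
  rw [hx, intervalIntegral.integral_const_mul, h0]
  simp

theorem boxFourier_ae_eq_of_mem_graph_opPow {ℓ : ℝ} (hℓ : 0 < ℓ) {n : ℕ} {φ η : L2I ℓ}
    (h : (φ, η) ∈ (opPow (minimalMomentum hℓ) n).graph) :
    boxFourier ℓ η =ᵐ[volume] fun x : ℝ => (x : ℂ) ^ n * boxFourier ℓ φ x := by
  induction n generalizing η with
  | zero =>
    rw [(mem_graph_opPow_zero_iff _).1 h]
    simp
  | succ n ih =>
    obtain ⟨θ, h1, h2⟩ := (mem_graph_opPow_succ_iff _).1 h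
    filter_upwards [ih h1, boxFourier_ae_eq_of_mem_graph hℓ h2] with x h3 h4
    rw [h4, h3]
    ring

/-! ### Test vectors that detect `dom P₀`: step functions and the exponential. -/

/-- The indicator function of `[0, b]` in `L²([0, ℓ])`. -/
noncomputable def stepFun (ℓ b : ℝ) : L2I ℓ :=
  ((memLp_const (1 : ℂ)).indicator (measurableSet_Iic (a := b))).toLp _

theorem stepFun_coeFn (ℓ b : ℝ) :
    stepFun ℓ b =ᵐ[volume.restrict (Icc 0 ℓ)] (Iic b).indicator fun _ => (1 : ℂ) :=
  MemLp.coeFn_toLp _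

theorem integral_mul_stepFun {ℓ b : ℝ} (hb : b ∈ Icc 0 ℓ) (f : ℝ → ℂ) :
    ∫ t in (0 : ℝ)..ℓ, f t * stepFun ℓ b t = ∫ t in (0 : ℝ)..b, f t := by
  rw [← intervalIntegral.integral_indicator hb]
  refine intervalIntegral_congr_of_ae_Icc ?_ (right_mem_Icc.2 (hb.1.trans hb.2))
  filter_upwards [stepFun_coeFn ℓ b] with t ht
  rw [ht]
  by_cases h : t ≤ b <;> simp [h, indicator]

/-- Keeping the factor `z` on the left avoids an exception at `z = 0`. -/
theorem integral_exp_mul {z : ℂ} (b : ℝ) :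
    z * ∫ t in (0 : ℝ)..b, Complex.exp (z * t) = Complex.exp (z * b) - 1 := by
  rcases eq_or_ne z 0 with rfl | hz
  · simp
  · rw [integral_exp_mul_complex hz]
    field_simp
    simp

/-- The right side is a difference of Fourier inversion kernels at `b` and `0`: pairing `x Wφ` with
a step function therefore gives the increment of the inverted function. -/
theorem mul_conj_boxFourier_stepFun {ℓ b : ℝ} (hℓ : 0 < ℓ) (hb : b ∈ Icc 0 ℓ) :
    ∀ᵐ x : ℝ, x * starRingEnd ℂ (boxFourier ℓ (stepFun ℓ b) x) =
      -Complex.I * fourierConst * (Complex.exp (Complex.I * x * b) - 1) := by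
  filter_upwards [boxFourier_ae_eq hℓ (stepFun ℓ b)] with x hx
  have h := congrArg (starRingEnd ℂ) (integral_exp_mul (z := -Complex.I * x) b)
  rw [map_mul, map_sub, ← Complex.exp_conj] at h
  simp only [map_mul, map_neg, Complex.conj_I, Complex.conj_ofReal, neg_neg, map_one] at h
  rw [hx, integral_mul_stepFun hb, map_mul, conj_fourierConst, ← h]
  linear_combination (x * fourierConst * starRingEnd ℂ
    (∫ t in (0 : ℝ)..b, Complex.exp (-Complex.I * x * t))) * Complex.I_mul_I

theorem integrable_exp_mul {f : ℝ → ℂ} (hf : Integrable f) (t : ℝ) :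
    Integrable fun x : ℝ => Complex.exp (Complex.I * x * t) * f x := by
  refine hf.norm.mono' ?_ (Filter.Eventually.of_forall fun x => ?_)
  · exact Continuous.aestronglyMeasurable (by fun_prop) |>.mul hf.aestronglyMeasurable
  · rw [norm_mul, Complex.norm_exp]
    simp

theorem continuous_integral_exp_mul {f : ℝ → ℂ} (hf : Integrable f) :
    Continuous fun t : ℝ => ∫ x : ℝ, Complex.exp (Complex.I * x * t) * f x := by
  refine continuous_of_dominated (fun t => (integrable_exp_mul hf t).aestronglyMeasurable)
    (fun t => Filter.Eventually.of_forall fun x => ?_) hf.norm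
    (Filter.Eventually.of_forall fun x => by fun_prop)
  rw [norm_mul, Complex.norm_exp]
  simp

/-- Integrability of `Wφ` gives the zero extension of `φ` a continuous version `Φ`. Its support
yields the boundary conditions, and step functions as `ψ` yield `Φ(b) = ∫₀ᵇ iη`. -/
theorem mem_graph_minimalMomentum_of_integrable {ℓ : ℝ} (hℓ : 0 < ℓ) {φ η : L2I ℓ}
    (hφ : Integrable (boxFourier ℓ φ))
    (h : ∀ ψ : L2I ℓ, ⟪ψ, η⟫_ℂ =
      ∫ x : ℝ, x * (starRingEnd ℂ (boxFourier ℓ ψ x) * boxFourier ℓ φ x)) :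
    (φ, η) ∈ (minimalMomentum hℓ).graph := by
  set Φ : ℝ → ℂ := fun t =>
    fourierConst * ∫ x : ℝ, Complex.exp (Complex.I * x * t) * boxFourier ℓ φ x with hΦ
  have hc : Continuous Φ := (continuous_integral_exp_mul hφ).const_mul _
  have hae : (Icc 0 ℓ).indicator φ =ᵐ[volume] Φ := ae_eq_boxFourier_inv hφ
  -- Passing to the closure is what reaches the endpoints `0` and `ℓ`.
  have hout : ∀ U : Set ℝ, IsOpen U → Disjoint U (Icc 0 ℓ) → EqOn Φ 0 (closure U) := by
    intro U hU hd
    refine EqOn.closure ?_ hc continuous_const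
    refine Measure.eqOn_open_of_ae_eq (μ := volume) ?_ hU hc.continuousOn continuousOn_const
    filter_upwards [ae_restrict_of_ae hae, ae_restrict_mem hU.measurableSet] with x hx hxU
    rw [← hx, indicator_of_notMem (hd.notMem_of_mem_left hxU)]
    rfl
  have h0 : Φ 0 = 0 := hout (Iio 0) isOpen_Iio
    (disjoint_left.2 fun x hx hx' => not_le.2 hx hx'.1) (by simp)
  have h1 : Φ ℓ = 0 := hout (Ioi ℓ) isOpen_Ioi
    (disjoint_left.2 fun x hx hx' => not_le.2 hx hx'.2) (by simp)
  have key : ∀ b ∈ Icc 0 ℓ, ∫ t in (0 : ℝ)..b, Complex.I * η t = Φ b := by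
    intro b hb
    have e1 : ⟪stepFun ℓ b, η⟫_ℂ = ∫ t in (0 : ℝ)..b, η t := by
      rw [inner_L2I_eq hℓ, ← integral_mul_stepFun hb]
      refine intervalIntegral_congr_of_ae_Icc ?_ (right_mem_Icc.2 hℓ.le)
      filter_upwards [stepFun_coeFn ℓ b] with t ht
      rw [ht, mul_comm]
      by_cases h : t ∈ Iic b <;> simp [h]
    have e2 : ∫ x : ℝ, x * (starRingEnd ℂ (boxFourier ℓ (stepFun ℓ b) x) * boxFourier ℓ φ x) =
        -Complex.I * (Φ b - Φ 0) := by
      rw [hΦ]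
      dsimp only
      rw [← mul_sub, ← integral_sub (integrable_exp_mul hφ b) (integrable_exp_mul hφ 0),
        ← mul_assoc, ← integral_const_mul]
      refine integral_congr_ae ?_
      filter_upwards [mul_conj_boxFourier_stepFun hℓ hb] with x hx
      rw [← mul_assoc, hx]
      simp
      ring
    rw [intervalIntegral.integral_const_mul, ← e1, h, e2, h0]
    linear_combination -Φ b * Complex.I_mul_I
  refine (mem_graph_minimalMomentum_iff hℓ).2 ⟨?_, ?_⟩
  · filter_upwards [ae_restrict_of_ae hae, ae_restrict_mem measurableSet_Icc] with x hx hxm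
    rw [key x hxm, ← hx, indicator_of_mem hxm]
  · have h2 := key ℓ (right_mem_Icc.2 hℓ.le)
    rw [h1, intervalIntegral.integral_const_mul] at h2
    simpa using h2

/-- The exponential function in `L²([0, ℓ])`. -/
noncomputable def expFun (ℓ : ℝ) : L2I ℓ :=
  (ContinuousOn.memLp_restrict_Icc (u := fun t : ℝ => Complex.exp t) (a := 0) (b := ℓ)
    (by fun_prop)).toLp _

/-- With `z = 1 - ix`, `z` times the integral of `e^(zt)` is `e^(zℓ) - 1`, of modulus at least `e^ℓ
- 1 > 0` for every `x`. A constant function would not do: its transform has zeros at nonzero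
multiples of `2π/ℓ`. -/
theorem exists_norm_boxFourier_expFun_ge {ℓ : ℝ} (hℓ : 0 < ℓ) :
    ∃ K : ℝ, 0 ≤ K ∧ ∀ᵐ x : ℝ, 1 ≤ |x| → 1 ≤ K * (|x| * ‖boxFourier ℓ (expFun ℓ) x‖) := by
  have hE : (0 : ℝ) < Real.exp ℓ - 1 := by linarith [Real.add_one_lt_exp hℓ.ne']
  have hc : 0 < ‖fourierConst‖ := norm_pos_iff.2 fourierConst_ne_zero
  -- The factor `2` comes from `|1 - ix| ≤ 2|x|` for `|x| ≥ 1`.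
  refine ⟨2 / (‖fourierConst‖ * (Real.exp ℓ - 1)), by positivity, ?_⟩
  have hcoe : expFun ℓ =ᵐ[volume.restrict (Icc 0 ℓ)] fun t : ℝ => Complex.exp t :=
    MemLp.coeFn_toLp _
  filter_upwards [boxFourier_ae_eq hℓ (expFun ℓ)] with x hx hx1
  set z : ℂ := 1 - Complex.I * x with hz
  have h1 : ∫ t in (0 : ℝ)..ℓ, Complex.exp (-Complex.I * x * t) * expFun ℓ t =
      ∫ t in (0 : ℝ)..ℓ, Complex.exp (z * t) := by
    refine intervalIntegral_congr_of_ae_Icc ?_ (right_mem_Icc.2 hℓ.le)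
    filter_upwards [hcoe] with t ht
    rw [ht, ← Complex.exp_add, hz]
    congr 1
    ring
  have h2 : Real.exp ℓ - 1 ≤ ‖z‖ * ‖∫ t in (0 : ℝ)..ℓ, Complex.exp (z * t)‖ := by
    rw [← norm_mul, integral_exp_mul]
    have h3 : ‖Complex.exp (z * ℓ)‖ = Real.exp ℓ := by
      rw [Complex.norm_exp, hz]
      simp
    have h4 := norm_sub_norm_le (Complex.exp (z * ℓ)) 1
    rwa [h3, norm_one] at h4
  have h3 : ‖z‖ ≤ 2 * |x| := by
    refine (norm_sub_le _ _).trans ?_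
    simp
    linarith
  rw [hx, norm_mul, h1]
  have h4 : Real.exp ℓ - 1 ≤ 2 * |x| * ‖∫ t in (0 : ℝ)..ℓ, Complex.exp (z * t)‖ :=
    h2.trans (mul_le_mul_of_nonneg_right h3 (norm_nonneg _))
  rw [div_mul_eq_mul_div, one_le_div (by positivity)]
  calc ‖fourierConst‖ * (Real.exp ℓ - 1)
      ≤ ‖fourierConst‖ * (2 * |x| * ‖∫ t in (0 : ℝ)..ℓ, Complex.exp (z * t)‖) := by gcongr
    _ = _ := by ring

/-- On `[-1, 1]` square integrability suffices; outside, the lower bound on the transform of `e^t`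
dominates `|Wφ|` by the given integrand. -/
theorem integrable_boxFourier_of_strong {ℓ : ℝ} (hℓ : 0 < ℓ) {φ : L2I ℓ}
    (h : Integrable fun x : ℝ =>
      (x : ℂ) * (starRingEnd ℂ (boxFourier ℓ (expFun ℓ) x) * boxFourier ℓ φ x)) :
    Integrable (boxFourier ℓ φ) := by
  obtain ⟨K, hK0, hK⟩ := exists_norm_boxFourier_expFun_ge hℓ
  have hloc : IntegrableOn (boxFourier ℓ φ) (Icc (-1) 1) :=
    ((Lp.memLp (boxFourier ℓ φ)).restrict _).integrable one_le_two
  refine ((hloc.integrable_indicator measurableSet_Icc).norm.add (h.norm.const_mul K)).mono'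
    (Lp.aestronglyMeasurable _) ?_
  filter_upwards [hK] with x hx
  rw [Pi.add_apply]
  by_cases hm : x ∈ Icc (-1) 1
  · rw [indicator_of_mem hm]
    exact le_add_of_nonneg_right (by positivity)
  · rw [indicator_of_notMem hm, norm_zero, zero_add]
    have h1 : 1 ≤ |x| := by
      by_contra! h2
      exact hm (abs_le.1 h2.le)
    simp only [norm_mul, Complex.norm_real, Real.norm_eq_abs, RCLike.norm_conj]
    calc ‖boxFourier ℓ φ x‖ ≤ K * (|x| * ‖boxFourier ℓ (expFun ℓ) x‖) * ‖boxFourier ℓ φ x‖ :=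
          le_mul_of_one_le_left (norm_nonneg _) (hx h1)
      _ = _ := by ring

/-! ### The moments -/

theorem memLp_of_mem_graph_opPow {ℓ : ℝ} (hℓ : 0 < ℓ) {n : ℕ} {φ η : L2I ℓ}
    (h : (φ, η) ∈ (opPow (minimalMomentum hℓ) n).graph) :
    MemLp (fun x : ℝ => (x : ℂ) ^ n * boxFourier ℓ φ x) 2 volume :=
  (memLp_congr_ae (boxFourier_ae_eq_of_mem_graph_opPow hℓ h)).1 (Lp.memLp _)

theorem integrable_pow_of_memLp {ℓ : ℝ} {n : ℕ} {φ : L2I ℓ}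
    (h : MemLp (fun x : ℝ => (x : ℂ) ^ n * boxFourier ℓ φ x) 2 volume) (ψ : L2I ℓ) :
    Integrable fun x : ℝ =>
      (x : ℂ) ^ n * (starRingEnd ℂ (boxFourier ℓ ψ x) * boxFourier ℓ φ x) := by
  refine ((Lp.memLp (boxFourier ℓ ψ)).star.integrable_mul h).congr
    (Filter.Eventually.of_forall fun x => ?_)
  simp only [Pi.mul_apply, Pi.star_apply, RCLike.star_def]
  ring

theorem formIntegral_of_mem_graph_opPow {ℓ : ℝ} (hℓ : 0 < ℓ) {n : ℕ} {φ η : L2I ℓ}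
    (h : (φ, η) ∈ (opPow (minimalMomentum hℓ) n).graph) (ψ : L2I ℓ) :
    (truncatedMomentum ℓ).formIntegral (fun x : ℝ => (x : ℂ) ^ n) ψ φ = ⟪ψ, η⟫_ℂ := by
  rw [formIntegral_truncatedMomentum ((integrable_complexMeasure_iff ψ φ n).2
    (integrable_pow_of_memLp (memLp_of_mem_graph_opPow hℓ h) ψ)), ← inner_boxFourier]
  refine integral_congr_ae ?_
  filter_upwards [boxFourier_ae_eq_of_mem_graph_opPow hℓ h] with x hx
  rw [hx]
  ring

theorem mem_strongDomain_iff {ℓ : ℝ} {k : ℕ} {φ : L2I ℓ} :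
    φ ∈ (truncatedMomentum ℓ).strongDomain (fun x : ℝ => (x : ℂ) ^ k) ↔
      ∀ ψ, Integrable fun x : ℝ =>
        (x : ℂ) ^ k * (starRingEnd ℂ (boxFourier ℓ ψ x) * boxFourier ℓ φ x) :=
  forall_congr' fun ψ => integrable_complexMeasure_iff ψ φ k

theorem mem_strongDomain_of_memLp {ℓ : ℝ} {k : ℕ} {φ : L2I ℓ}
    (h : MemLp (fun x : ℝ => (x : ℂ) ^ k * boxFourier ℓ φ x) 2 volume) :
    φ ∈ (truncatedMomentum ℓ).strongDomain (fun x : ℝ => (x : ℂ) ^ k) :=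
  mem_strongDomain_iff.2 (integrable_pow_of_memLp h)

theorem mem_strongDomain_of_mem_graph {ℓ : ℝ} (hℓ : 0 < ℓ) {k : ℕ} {φ η : L2I ℓ}
    (h : (φ, η) ∈ (opPow (minimalMomentum hℓ) k).graph) :
    φ ∈ (truncatedMomentum ℓ).strongDomain (fun x : ℝ => (x : ℂ) ^ k) :=
  mem_strongDomain_of_memLp (memLp_of_mem_graph_opPow hℓ h)

theorem strongDomain_succ_le {ℓ : ℝ} {k : ℕ} :
    (truncatedMomentum ℓ).strongDomain (fun x : ℝ => (x : ℂ) ^ (k + 1)) ≤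
      (truncatedMomentum ℓ).strongDomain (fun x : ℝ => (x : ℂ) ^ k) := by
  intro φ hφ
  rw [mem_strongDomain_iff] at hφ ⊢
  intro ψ
  have h0 := integrable_conj_mul_boxFourier ψ φ
  refine (h0.norm.add (hφ ψ).norm).mono' ?_ (Filter.Eventually.of_forall fun x => ?_)
  · exact (Continuous.aestronglyMeasurable (by fun_prop)).mul h0.aestronglyMeasurable
  · simp only [Pi.add_apply, norm_mul, norm_pow, Complex.norm_real, RCLike.norm_conj]
    have hp : ‖x‖ ^ k ≤ 1 + ‖x‖ ^ (k + 1) := by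
      rcases le_total ‖x‖ 1 with h | h
      · exact (pow_le_one₀ (norm_nonneg _) h).trans (le_add_of_nonneg_right (by positivity))
      · exact (pow_le_pow_right₀ h k.le_succ).trans (le_add_of_nonneg_left zero_le_one)
    calc ‖x‖ ^ k * (‖boxFourier ℓ ψ x‖ * ‖boxFourier ℓ φ x‖)
        ≤ (1 + ‖x‖ ^ (k + 1)) * (‖boxFourier ℓ ψ x‖ * ‖boxFourier ℓ φ x‖) := by gcongr
      _ = _ := by ring

theorem exists_mem_graph_minimalMomentum {ℓ : ℝ} (hℓ : 0 < ℓ) {φ : L2I ℓ}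
    (hφ : φ ∈ (truncatedMomentum ℓ).strongDomain (fun x : ℝ => (x : ℂ) ^ 1)) :
    ∃ η, (φ, η) ∈ (minimalMomentum hℓ).graph := by
  obtain ⟨η, hη⟩ := (truncatedMomentum ℓ).exists_strong (by fun_prop) hφ
  have hi := mem_strongDomain_iff.1 hφ
  simp only [pow_one] at hi
  refine ⟨η, mem_graph_minimalMomentum_of_integrable hℓ
    (integrable_boxFourier_of_strong hℓ (hi _)) fun ψ => ?_⟩
  rw [hη, formIntegral_truncatedMomentum (hφ ψ)]
  simp only [pow_one]

/-- With `θ = P₀^k φ` one has `Wθ = x^k Wφ`, so the condition of order `k + 1` on `φ` is the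
condition of order `1` on `θ`. -/
theorem exists_mem_graph_opPow_of_mem_strongDomain {ℓ : ℝ} (hℓ : 0 < ℓ) {k : ℕ} {φ : L2I ℓ}
    (hφ : φ ∈ (truncatedMomentum ℓ).strongDomain (fun x : ℝ => (x : ℂ) ^ k)) :
    ∃ η, (φ, η) ∈ (opPow (minimalMomentum hℓ) k).graph := by
  induction k with
  | zero => exact ⟨φ, (mem_graph_opPow_zero_iff _).2 rfl⟩
  | succ k ih =>
    obtain ⟨θ, hθ⟩ := ih (strongDomain_succ_le hφ)
    have h1 : θ ∈ (truncatedMomentum ℓ).strongDomain (fun x : ℝ => (x : ℂ) ^ 1) := by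
      rw [mem_strongDomain_iff] at hφ ⊢
      intro ψ
      refine (hφ ψ).congr ?_
      filter_upwards [boxFourier_ae_eq_of_mem_graph_opPow hℓ hθ] with x hx
      rw [hx]
      ring
    obtain ⟨η, hη⟩ := exists_mem_graph_minimalMomentum hℓ h1
    exact ⟨η, (mem_graph_opPow_succ_iff _).2 ⟨θ, hθ, hη⟩⟩

/-- The strong moments of the truncated momentum are the powers of the minimal momentum
operator. -/
theorem strongMoment_truncatedMomentum {ℓ : ℝ} (hℓ : 0 < ℓ) (k : ℕ) :
    (truncatedMomentum ℓ).strongMoment k = opPow (minimalMomentum hℓ) k := by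
  refine LinearPMap.eq_of_eq_graph ?_
  ext ⟨φ, η⟩
  rw [POVM.strongMoment, POVM.mem_graph_strongIntegral_iff]
  constructor
  · rintro ⟨hφ, h⟩
    obtain ⟨η', hη'⟩ := exists_mem_graph_opPow_of_mem_strongDomain hℓ hφ
    have : η = η' := ext_inner_left ℂ fun ψ => by
      rw [h, formIntegral_of_mem_graph_opPow hℓ hη']
    rwa [this]
  · intro h
    exact ⟨mem_strongDomain_of_mem_graph hℓ h, fun ψ =>
      (formIntegral_of_mem_graph_opPow hℓ h ψ).symm⟩

/-! ### Form domains and the even weak moments. -/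

theorem dense_formDomain {ℓ : ℝ} (hℓ : 0 < ℓ) (k : ℕ) :
    Dense ((truncatedMomentum ℓ).formDomain (fun x : ℝ => (x : ℂ) ^ k) : Set (L2I ℓ)) := by
  refine (dense_opPow_minimalMomentum hℓ k).mono fun φ hφ => ?_
  exact POVM.strongDomain_le_formDomain _ _
    (mem_strongDomain_of_mem_graph hℓ (LinearPMap.mem_graph _ ⟨φ, hφ⟩))

/-- Finiteness of `∫ x^(2n) |Wφ|²` says `x^n Wφ ∈ L²`. Paired with any `Wψ ∈ L²` this is integrable,
so `φ` lies in the strong domain of order `n`, which is `dom P₀^n`. -/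
theorem mem_formDomain_even_iff {ℓ : ℝ} (hℓ : 0 < ℓ) {n : ℕ} {φ : L2I ℓ} :
    φ ∈ (truncatedMomentum ℓ).formDomain (fun x : ℝ => (x : ℂ) ^ (2 * n)) ↔
      ∃ η, (φ, η) ∈ (opPow (minimalMomentum hℓ) n).graph := by
  have hm : AEStronglyMeasurable (fun x : ℝ => (x : ℂ) ^ n * boxFourier ℓ φ x) volume :=
    (Continuous.aestronglyMeasurable (by fun_prop)).mul (Lp.aestronglyMeasurable _)
  have key : φ ∈ (truncatedMomentum ℓ).formDomain (fun x : ℝ => (x : ℂ) ^ (2 * n)) ↔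
      MemLp (fun x : ℝ => (x : ℂ) ^ n * boxFourier ℓ φ x) 2 volume := by
    refine (integrable_complexMeasure_iff φ φ (2 * n)).trans ?_
    rw [memLp_two_iff_integrable_sq_norm hm]
    refine integrable_congr' ?_ (hm.norm.pow 2) (Filter.Eventually.of_forall fun x => ?_)
    · exact (Continuous.aestronglyMeasurable (by fun_prop)).mul
        (integrable_conj_mul_boxFourier φ φ).aestronglyMeasurable
    · simp only [norm_mul, norm_pow, RCLike.norm_conj, norm_norm]
      ring
  rw [key]
  exact ⟨fun h => exists_mem_graph_opPow_of_mem_strongDomain hℓ (mem_strongDomain_of_memLp h),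
    fun ⟨η, h⟩ => memLp_of_mem_graph_opPow hℓ h⟩

theorem formIntegral_even {ℓ : ℝ} (hℓ : 0 < ℓ) {n : ℕ} {ψ ζ φ θ : L2I ℓ}
    (hψ : (ψ, ζ) ∈ (opPow (minimalMomentum hℓ) n).graph)
    (hφ : (φ, θ) ∈ (opPow (minimalMomentum hℓ) n).graph) :
    (truncatedMomentum ℓ).formIntegral (fun x : ℝ => (x : ℂ) ^ (2 * n)) ψ φ = ⟪ζ, θ⟫_ℂ := by
  rw [formIntegral_truncatedMomentum (POVM.integrable_of_mem _
    ((mem_formDomain_even_iff hℓ).2 ⟨ζ, hψ⟩) ((mem_formDomain_even_iff hℓ).2 ⟨θ, hφ⟩)),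
    ← inner_boxFourier]
  refine integral_congr_ae ?_
  filter_upwards [boxFourier_ae_eq_of_mem_graph_opPow hℓ hψ,
    boxFourier_ae_eq_of_mem_graph_opPow hℓ hφ] with x h1 h2
  rw [h1, h2]
  simp only [map_mul, map_pow, Complex.conj_ofReal]
  ring

theorem mem_graph_adjoint_opPow_iff {ℓ : ℝ} (hℓ : 0 < ℓ) {n : ℕ} {θ η : L2I ℓ} :
    (θ, η) ∈ (opPow (minimalMomentum hℓ) n).adjoint.graph ↔
      ∀ ψ ζ, (ψ, ζ) ∈ (opPow (minimalMomentum hℓ) n).graph → ⟪ζ, θ⟫_ℂ = ⟪ψ, η⟫_ℂ := by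
  rw [LinearPMap.adjoint_graph_eq_graph_adjoint (dense_opPow_minimalMomentum hℓ n),
    Submodule.mem_adjoint_iff]
  simp only [sub_eq_zero]

/-- As the form is `⟪P₀^n ψ, P₀^n φ⟫` on `dom P₀^n`, the relation defining the weak moment is the
adjoint relation for `P₀^n φ`. -/
theorem weakMoment_even {ℓ : ℝ} (hℓ : 0 < ℓ) (n : ℕ) :
    (truncatedMomentum ℓ).weakMoment (2 * n) =
      opMul (opPow (minimalMomentum hℓ) n).adjoint (opPow (minimalMomentum hℓ) n) := by
  refine LinearPMap.eq_of_eq_graph ?_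
  ext ⟨φ, η⟩
  rw [POVM.weakMoment, POVM.mem_graph_weakIntegral_iff _ (dense_formDomain hℓ _),
    mem_graph_opMul_iff]
  simp only [mem_graph_adjoint_opPow_iff]
  constructor
  · rintro ⟨hφ, h⟩
    obtain ⟨θ, hθ⟩ := (mem_formDomain_even_iff hℓ).1 hφ
    refine ⟨θ, hθ, fun ψ ζ hψ => ?_⟩
    rw [h ψ ((mem_formDomain_even_iff hℓ).2 ⟨ζ, hψ⟩), formIntegral_even hℓ hψ hθ]
  · rintro ⟨θ, hθ, h⟩
    refine ⟨(mem_formDomain_even_iff hℓ).2 ⟨θ, hθ⟩, fun ψ hψ => ?_⟩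
    obtain ⟨ζ, hζ⟩ := (mem_formDomain_even_iff hℓ).1 hψ
    rw [formIntegral_even hℓ hζ hθ, h ψ ζ hζ]

theorem weakMoment_even_eq_momentumOp {ℓ : ℝ} (hℓ : 0 < ℓ) (n : ℕ) :
    (truncatedMomentum ℓ).weakMoment (2 * n) =
      momentumOp hℓ (Nat.le_mul_of_pos_left n two_pos) := by
  rw [weakMoment_even hℓ]
  refine LinearPMap.eq_of_eq_graph ?_
  ext ⟨φ, η⟩
  rw [mem_graph_opMul_iff, adjoint_opPow_minimalMomentum, opPow_minimalMomentum,
    mem_graph_momentumOp_add_iff hℓ (two_mul n)]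

theorem weakMoment_two_eq_smul {ℓ : ℝ} (hℓ : 0 < ℓ) {m : ℝ} (hm : 0 < m) :
    (truncatedMomentum ℓ).weakMoment 2 = (2 * (m : ℂ)) • boxHamiltonian hℓ m := by
  have hm' : (2 * (m : ℂ)) ≠ 0 := by
    simpa using hm.ne'
  -- Both sides are `-1`; the exponent `2 * 1` is the form in which `weakMoment_even_eq_momentumOp`
  -- delivers it.
  have hk : 2 * (m : ℂ) * -(2 * (m : ℂ))⁻¹ = (-Complex.I) ^ (2 * 1) := by
    rw [mul_neg, mul_inv_cancel₀ hm']
    simp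
  rw [weakMoment_even_eq_momentumOp hℓ 1]
  refine LinearPMap.eq_of_eq_graph ?_
  rw [LinearPMap.smul_graph, boxHamiltonian, diffOp_graph]
  ext ⟨φ, η⟩
  rw [mem_graph_momentumOp_iff, Submodule.mem_map]
  constructor
  · rintro ⟨u, g, hu, hφ, hb, rfl⟩
    refine ⟨(φ, -(2 * (m : ℂ))⁻¹ • g), ⟨u, g, hu, hφ, hb, rfl⟩, Prod.ext rfl ?_⟩
    change (2 * (m : ℂ)) • (-(2 * (m : ℂ))⁻¹ • g) = _
    rw [smul_smul, hk]
  · rintro ⟨⟨φ', η'⟩, ⟨u, g, hu, hφ, hb, hg⟩, he⟩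
    obtain ⟨rfl, rfl⟩ := Prod.ext_iff.1 he
    refine ⟨u, g, hu, hφ, hb, ?_⟩
    dsimp only at hg
    subst hg
    change (2 * (m : ℂ)) • (-(2 * (m : ℂ))⁻¹ • g) = _
    rw [smul_smul, hk]

/-! ### The first weak moment -/

/-- A shift by the half period `a` changes the sign of the exponential. By the parallelogram law the
squares of the function and of its shift add up to the constant `2(|C|² + |D|²)`, and a nonzero
constant times `1/x` is not integrable at infinity. -/
theorem eq_zero_of_integrable_boundary {a : ℝ} (ha : 0 < a) {C D : ℂ}
    (h : IntegrableOn (fun x : ℝ =>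
      ‖D * Complex.exp (-Complex.I * x * (Real.pi / a : ℝ)) - C‖ ^ 2 * x⁻¹) (Ioi 1)) :
    C = 0 ∧ D = 0 := by
  set f : ℝ → ℂ := fun x => D * Complex.exp (-Complex.I * x * (Real.pi / a : ℝ)) - C with hf
  have hshift : ∀ x : ℝ, f (x - a) = -(D * Complex.exp (-Complex.I * x * (Real.pi / a : ℝ))) - C := by
    intro x
    have ha' : (a : ℂ) ≠ 0 := by exact_mod_cast ha.ne'
    have e : -Complex.I * ((x - a : ℝ) : ℂ) * (Real.pi / a : ℝ) =
        -Complex.I * x * (Real.pi / a : ℝ) + Real.pi * Complex.I := by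
      push_cast
      field_simp
      ring
    rw [hf]
    dsimp only
    rw [e, Complex.exp_add, Complex.exp_pi_mul_I]
    ring
  have hpar : ∀ x : ℝ, ‖f x‖ ^ 2 + ‖f (x - a)‖ ^ 2 = 2 * (‖D‖ ^ 2 + ‖C‖ ^ 2) := by
    intro x
    have h1 := parallelogram_law_with_norm ℝ (D * Complex.exp (-Complex.I * x * (Real.pi / a : ℝ))) C
    have h2 : ‖D * Complex.exp (-Complex.I * x * (Real.pi / a : ℝ))‖ = ‖D‖ := by
      rw [norm_mul, Complex.norm_exp]
      simp
    have h3 : ‖f (x - a)‖ = ‖D * Complex.exp (-Complex.I * x * (Real.pi / a : ℝ)) + C‖ := by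
      rw [hshift, ← norm_neg]
      congr 1
      ring
    rw [h2] at h1
    rw [h3]
    simp only [hf]
    nlinarith [h1]
  have hs : IntegrableOn (fun x : ℝ => ‖f (x - a)‖ ^ 2 * (x - a)⁻¹) (Ioi (1 + a)) := by
    have h1 := (integrable_indicator_iff measurableSet_Ioi).2 h
    have h2 := (integrable_indicator_iff measurableSet_Ioi).1 ((h1.comp_sub_right a).congr
      (Filter.Eventually.of_forall fun x => (?_ : _ = (Ioi (1 + a)).indicator
        (fun x : ℝ => ‖f (x - a)‖ ^ 2 * (x - a)⁻¹) x)))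
    · exact h2
    · by_cases hx : x ∈ Ioi (1 + a)
      · have : x - a ∈ Ioi (1 : ℝ) := by simp only [mem_Ioi] at *; linarith
        dsimp only
        rw [indicator_of_mem hx, indicator_of_mem this]
      · have : x - a ∉ Ioi (1 : ℝ) := by simp only [mem_Ioi] at *; linarith
        dsimp only
        rw [indicator_of_notMem hx, indicator_of_notMem this]
  have hsum : IntegrableOn (fun x : ℝ => 2 * (‖D‖ ^ 2 + ‖C‖ ^ 2) * x⁻¹) (Ioi (1 + a)) := by
    refine ((h.mono_set (Ioi_subset_Ioi (by linarith))).add hs).mono' ?_ ?_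
    · exact (measurable_inv.const_mul _).aestronglyMeasurable
    · filter_upwards [ae_restrict_mem measurableSet_Ioi] with x hx
      have hx' : 1 + a < x := hx
      have hx0 : 0 < x - a := by linarith
      -- The weight of the shifted term is the larger one, so both terms can be compared with weight
      -- `1/x`.
      have hx1 : x⁻¹ ≤ (x - a)⁻¹ := inv_anti₀ hx0 (by linarith)
      have hxp : 0 < x := by linarith
      rw [Real.norm_of_nonneg (by positivity), ← hpar x, add_mul, Pi.add_apply]
      gcongr
  by_contra hne
  have hK : 2 * (‖D‖ ^ 2 + ‖C‖ ^ 2) ≠ 0 := by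
    intro h0
    have h1 : ‖D‖ = 0 := by nlinarith [sq_nonneg ‖D‖, sq_nonneg ‖C‖]
    have h2 : ‖C‖ = 0 := by nlinarith [sq_nonneg ‖D‖, sq_nonneg ‖C‖]
    exact hne ⟨norm_eq_zero.1 h2, norm_eq_zero.1 h1⟩
  have h1 := hsum.const_mul (2 * (‖D‖ ^ 2 + ‖C‖ ^ 2))⁻¹
  simp only [← mul_assoc, inv_mul_cancel₀ hK, one_mul] at h1
  exact not_integrableOn_Ioi_inv h1

/-- The adjoint relation alone allows arbitrary endpoint values; they are excluded by `φ` itself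
lying in `D_1`, since a nonzero one makes `∫ |x| |Wφ|²` diverge logarithmically. -/
theorem weakMoment_one {ℓ : ℝ} (hℓ : 0 < ℓ) :
    (truncatedMomentum ℓ).weakMoment 1 = minimalMomentum hℓ := by
  refine LinearPMap.eq_of_eq_graph ?_
  ext ⟨φ, η⟩
  rw [POVM.weakMoment, POVM.mem_graph_weakIntegral_iff _ (dense_formDomain hℓ _),
    ← opPow_one (minimalMomentum hℓ)]
  constructor
  swap
  · intro h
    exact ⟨POVM.strongDomain_le_formDomain _ _ (mem_strongDomain_of_mem_graph hℓ h),
      fun ψ _ => (formIntegral_of_mem_graph_opPow hℓ h ψ).symm⟩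
  rintro ⟨hφ, h⟩
  have hadj : (φ, η) ∈ (opPow (minimalMomentum hℓ) 1).adjoint.graph := by
    refine (mem_graph_adjoint_opPow_iff hℓ).2 fun ψ ζ hψ => ?_
    have hψD := POVM.strongDomain_le_formDomain _ _ (mem_strongDomain_of_mem_graph hℓ hψ)
    rw [h ψ hψD, formIntegral_truncatedMomentum (POVM.integrable_of_mem _ hψD hφ),
      ← inner_boxFourier]
    refine integral_congr_ae ?_
    filter_upwards [boxFourier_ae_eq_of_mem_graph_opPow hℓ hψ] with x hx
    rw [hx]
    simp only [map_mul, map_pow, Complex.conj_ofReal]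
    ring
  rw [adjoint_opPow_minimalMomentum] at hadj
  obtain ⟨C, hC⟩ := (mem_graph_momentumOp_one_zero_iff hℓ).1 hadj
  have hW := boxFourier_ae_eq_of_primitive hℓ hC
  set D : ℂ := C + ∫ t in (0 : ℝ)..ℓ, Complex.I * η t with hD
  have hφi := (integrable_complexMeasure_iff φ φ 1).1 hφ
  have hηi := integrable_conj_mul_boxFourier η η
  have hc : 0 < ‖fourierConst‖ := norm_pos_iff.2 fourierConst_ne_zero
  -- The half period is `π/ℓ`, hence the nested quotient, which equals `ℓ`.
  have hbd : IntegrableOn (fun x : ℝ =>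
      ‖D * Complex.exp (-Complex.I * x * (Real.pi / (Real.pi / ℓ) : ℝ)) - C‖ ^ 2 * x⁻¹)
      (Ioi 1) := by
    have hpi : Real.pi / (Real.pi / ℓ) = ℓ := by
      field_simp
    rw [hpi]
    -- The `2` is from `(p + q)² ≤ 2(p² + q²)` applied to `x Wφ - Wη`. After division by `x`, the
    -- first term is the `D_1` integrand and the second is at most `|Wη|²`, since `x > 1`.
    refine (((hφi.norm.add hηi.norm).const_mul (2 / ‖fourierConst‖ ^ 2)).integrableOn
      (s := Ioi 1)).mono' ?_ ?_
    · exact (Measurable.mul (Continuous.measurable (by fun_prop))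
        measurable_inv).aestronglyMeasurable
    · filter_upwards [ae_restrict_of_ae hW, ae_restrict_mem measurableSet_Ioi] with x hx hx1
      have hx1' : (1 : ℝ) < x := hx1
      have hx0 : 0 < x := by linarith
      set F := D * Complex.exp (-Complex.I * x * ℓ) - C with hF
      have h1 : Complex.I * fourierConst * F = x * boxFourier ℓ φ x - boxFourier ℓ η x := by
        rw [hx]
        ring
      have h2 : ‖fourierConst‖ * ‖F‖ ≤ x * ‖boxFourier ℓ φ x‖ + ‖boxFourier ℓ η x‖ := by
        have h3 := congrArg norm h1
        rw [norm_mul, norm_mul, Complex.norm_I, one_mul] at h3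
        rw [h3]
        refine (norm_sub_le _ _).trans_eq ?_
        rw [norm_mul, Complex.norm_real, Real.norm_of_nonneg hx0.le]
      rw [Real.norm_of_nonneg (by positivity)]
      simp only [Pi.add_apply, norm_mul, pow_one, RCLike.norm_conj, Complex.norm_real,
        Real.norm_of_nonneg hx0.le]
      rw [div_mul_eq_mul_div, le_div_iff₀ (by positivity)]
      have h4 : (‖fourierConst‖ * ‖F‖) ^ 2 ≤
          2 * ((x * ‖boxFourier ℓ φ x‖) ^ 2 + ‖boxFourier ℓ η x‖ ^ 2) :=
        (pow_le_pow_left₀ (by positivity) h2 2).trans add_sq_le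
      calc ‖F‖ ^ 2 * x⁻¹ * ‖fourierConst‖ ^ 2 = (‖fourierConst‖ * ‖F‖) ^ 2 * x⁻¹ := by ring
        _ ≤ 2 * ((x * ‖boxFourier ℓ φ x‖) ^ 2 + ‖boxFourier ℓ η x‖ ^ 2) * x⁻¹ := by gcongr
        _ = 2 * (x * ‖boxFourier ℓ φ x‖ ^ 2 + ‖boxFourier ℓ η x‖ ^ 2 * x⁻¹) := by
          field_simp
        _ ≤ 2 * (x * ‖boxFourier ℓ φ x‖ ^ 2 + ‖boxFourier ℓ η x‖ ^ 2 * 1) := by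
          gcongr
          exact inv_le_one_of_one_le₀ hx1'.le
        _ = _ := by ring
  obtain ⟨hC0, hD0⟩ := eq_zero_of_integrable_boundary (by positivity) hbd
  rw [opPow_one]
  rw [hD, hC0, zero_add, intervalIntegral.integral_const_mul] at hD0
  exact (mem_graph_minimalMomentum_iff hℓ).2 ⟨by simpa [hC0] using hC, by simpa using hD0⟩

theorem mainTheorem3 (ℓ : ℝ) (hℓ : 0 < ℓ) :
    -- all the operators involved are well defined
    (∀ k : ℕ, Dense ((truncatedMomentum ℓ).formDomain (fun x : ℝ => (x : ℂ) ^ k) : Set (L2I ℓ))) ∧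
    (∀ n : ℕ, Dense ((opPow (minimalMomentum hℓ) n).domain : Set (L2I ℓ))) ∧
    -- the first weak moment
    (truncatedMomentum ℓ).weakMoment 1 = minimalMomentum hℓ ∧
    -- the even weak moments
    (∀ n : ℕ, (truncatedMomentum ℓ).weakMoment (2 * n) =
      opMul (opPow (minimalMomentum hℓ) n).adjoint (opPow (minimalMomentum hℓ) n)) ∧
    -- the even strong and weak moments act as `(-i d/dx)^(2n)` on `H^(2n)`, with all `2n` boundary
    -- conditions and with the first `n` of them respectively
    (∀ n : ℕ,
      (truncatedMomentum ℓ).strongMoment (2 * n) = opPow (minimalMomentum hℓ) (2 * n) ∧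
      (truncatedMomentum ℓ).strongMoment (2 * n) = momentumOp hℓ (le_refl (2 * n)) ∧
      (truncatedMomentum ℓ).weakMoment (2 * n) =
        momentumOp hℓ (Nat.le_mul_of_pos_left n two_pos)) ∧
    -- the second weak moment is the Dirichlet Hamiltonian of the box up to the factor `2m`
    (truncatedMomentum ℓ).weakMoment 2 =
      opMul (minimalMomentum hℓ).adjoint (minimalMomentum hℓ) ∧
    (∀ m : ℝ, 0 < m →
      (truncatedMomentum ℓ).weakMoment 2 = (2 * (m : ℂ)) • boxHamiltonian hℓ m) := by
  refine ⟨dense_formDomain hℓ, dense_opPow_minimalMomentum hℓ, weakMoment_one hℓ,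
    weakMoment_even hℓ, fun n => ⟨strongMoment_truncatedMomentum hℓ _, ?_,
      weakMoment_even_eq_momentumOp hℓ n⟩, ?_, fun m hm => weakMoment_two_eq_smul hℓ hm⟩
  · rw [strongMoment_truncatedMomentum hℓ, opPow_minimalMomentum]
  · have h := weakMoment_even hℓ 1
    rwa [opPow_one] at h
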